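/- **Setting.** Let $\phi:\mathcal S\times\mathcal A\to\mathbb R^d$ be a measurable feature map, $\rho$ a probability distribution on states and $\mu(\cdot\mid s)$ a distribution on pairs of actions. Let $\sigma(z)=1/(1+e^{-z})$ and $n\ge 2$. The data are $n$ i.i.d. samples $(s_t,a_t^0,a_t^1,y_t,\widetilde y_t)$, where $s_t\sim\rho$, $(a^0_t,a^1_t)\sim\mu(\cdot\mid s_t)$, and the label $y_t\in\{0,1\}$ follows the Bradley–Terry–Luce model $$\mathbb P[y_t=l\mid s_t,a_t^0,a_t^1]=\frac{e^{\phi(s_t,a_t^l)^\top\theta^*}}{e^{\phi(s_t,a_t^0)^\top\theta^*}+e^{\phi(s_t,a_t^1)^\top\theta^*}},$$ and $\widetilde y_t$ is the output of randomized response with privacy budget $\epsilon$ on $y_t$: given $(s_t,a^0_t,a^1_t,y_t)$, $\widetilde y_t=y_t$ with probability $e^\epsilon/(1+e^\epsilon)=\sigma(\epsilon)$ and $\widetilde y_t=1-y_t$ otherwise. Put $x_t=\phi(s_t,a_t^1)-\phi(s_t,a_t^0)$, $\Sigma=\mathbb E[x_tx_t^\top]$, and $\Theta_B=\{\theta\in\mathbb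 R^d:\langle\mathbf 1,\theta\rangle=0,\ \|\theta\|_2\le B\}$. **Assumptions.** (Boundedness) $\theta^*\in\Theta_B$ and $\|\phi(s,a)\|_2\le L$ for all $(s,a)$. (Coverage) $\lambda_{\min}(\Sigma)\ge\kappa$ with $\kappa>0$. **Algorithm.** Let $\gamma=\dfrac1{2+e^{-2LB}+e^{2LB}}$, $\gamma_\epsilon=(2\sigma(\epsilon)-1)\gamma$ and $\eta_t=\dfrac1{\gamma_\epsilon\kappa t}$. One-pass projected SGD with randomized response sets $\hat\theta_1=0$ and $$\hat\theta_{t+1}=\Pi_{\Theta_B}\big(\hat\theta_t-\eta_t\hat g_t\big),\quad 1\le t\le n,\qquad \hat g_t=-\nabla_\theta\log\hat p_{t,\widetilde y_t}(\theta)\big|_{\theta=\hat\theta_t},$$ where $\Pi_{\Theta_B}$ is the Euclidean projection onto $\Theta_B$ and $$\hat p_{t,1}(\theta)=\frac{\sigma(x_t^\top\theta)^{\sigma(\epsilon)}}{(1-\sigma(x_t^\top\theta))^{1-\sigma(\epsilon)}},\qquad \hat p_{t,0}(\theta)=\frac{(1-\sigma(x_t^\top\theta))^{\sigma(\epsilon)}}{\sigma(x_t^\top\theta)^{1-\sigma(\epsilon)}}.$$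 The output is $\hat\theta_{\texttt{SGD-RR}}=\hat\theta_{n+1}$. **Theorem.** There is an absolute constant $C>0$ such that, in this setting, for every $\alpha\in(0,1/e)$ and every $\epsilon>0$, with probability at least $1-\alpha$, simultaneously for all $1\le t\le n$, $$\|\hat\theta_{t+1}-\theta^*\|_2\le C\cdot\frac{L}{\gamma\kappa}\cdot\frac{e^\epsilon+1}{e^\epsilon-1}\cdot\sqrt{\frac{\log(\log(n)/\alpha)}{t}}.$$ In particular (the case $t=n$), $\|\hat\theta_{\texttt{SGD-RR}}-\theta^*\|_2\le C\cdot\frac{L}{\gamma\kappa}\cdot\frac{e^\epsilon+1}{e^\epsilon-1}\cdot\sqrt{\frac{\log(\log(n)/\alpha)}{n}}$ on that event. -/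

import Mathlib

open MeasureTheory ProbabilityTheory

noncomputable section

namespace PrivatePreference

/-- The parameter space `ℝ^d` with the Euclidean norm. -/
abbrev Vec (d : ℕ) : Type := EuclideanSpace ℝ (Fin d)

/-- A state together with the pair of actions `(a⁰, a¹)`. -/
abbrev Query (S A : Type*) : Type _ := S × (A × A)

/-- One sample of the locally private data set: the query `(s, (a⁰, a¹))`, the clear-text label `y`
and the randomized label `ỹ` (labels: `true` is `1`, `false` is `0`). -/
abbrev Sample (S A : Type*) : Type _ := (Query S A × Bool) × Bool

section Model

variable {S A : Type*} {d : ℕ}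

/-- The differential feature `x = φ(s, a¹) - φ(s, a⁰)`. -/
def diffFeature (φ : S → A → Vec d) (q : Query S A) : Vec d :=
  φ q.1 q.2.2 - φ q.1 q.2.1

/-- The linear reward `r_θ(s, a) = φ(s, a)ᵀ θ`. -/
def reward (φ : S → A → Vec d) (θ : Vec d) (s : S) (a : A) : ℝ :=
  inner ℝ (φ s a) θ

/-- The Bradley-Terry-Luce probability of the label `1`:
`exp (r_θ(s, a¹)) / (exp (r_θ(s, a⁰)) + exp (r_θ(s, a¹)))`. -/
def btlProb (φ : S → A → Vec d) (θ : Vec d) (q : Query S A) : unitInterval :=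
  ⟨Real.exp (reward φ θ q.1 q.2.2) /
      (Real.exp (reward φ θ q.1 q.2.1) + Real.exp (reward φ θ q.1 q.2.2)),
    div_nonneg (Real.exp_pos _).le (by positivity),
    div_le_one_of_le₀ (by linarith [Real.exp_pos (reward φ θ q.1 q.2.1)]) (by positivity)⟩

lemma measurable_bernoulli :
    Measurable (fun p : unitInterval => bernoulliMeasure true false p) := by
  refine Measure.measurable_of_measurable_coe _ fun s hs => ?_
  simp only [bernoulliMeasure_def, Measure.add_apply, Measure.smul_apply]
  have h1 : Measurable (fun p : unitInterval => unitInterval.toNNReal p) := by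
    fun_prop
  have h2 : Measurable (fun p : unitInterval => unitInterval.toNNReal (unitInterval.symm p)) := by
    fun_prop
  exact (h1.smul_const _).add (h2.smul_const _)

variable [MeasurableSpace S] [MeasurableSpace A]

lemma measurable_btlProb {φ : S → A → Vec d} (hφ : Measurable (Function.uncurry φ))
    (θ : Vec d) : Measurable (btlProb φ θ) := by
  have h : ∀ f : Query S A → A, Measurable f →
      Measurable (fun q : Query S A => reward φ θ q.1 (f q)) := by
    intro f hf
    have : Measurable (fun q : Query S A => φ q.1 (f q)) :=
      hφ.comp (measurable_fst.prodMk hf)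
    unfold reward
    fun_prop
  have h0 := h (fun q => q.2.1) (by fun_prop)
  have h1 := h (fun q => q.2.2) (by fun_prop)
  refine Measurable.subtype_mk ?_
  fun_prop

/-- The conditional law of the clear-text label `y` given the query, for the parameter `θ`. -/
def labelKernel (φ : S → A → Vec d) (hφ : Measurable (Function.uncurry φ)) (θ : Vec d) :
    Kernel (Query S A) Bool where
  toFun q := bernoulliMeasure true false (btlProb φ θ q)
  measurable' := measurable_bernoulli.comp (measurable_btlProb hφ θ)

instance (φ : S → A → Vec d) (hφ : Measurable (Function.uncurry φ)) (θ : Vec d) :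
    IsMarkovKernel (labelKernel φ hφ θ) :=
  ⟨fun q => inferInstanceAs (IsProbabilityMeasure (bernoulliMeasure true false (btlProb φ θ q)))⟩

/-- Randomized response with privacy budget `ε`: the label is kept with probability
`e^ε / (1 + e^ε) = (1 + e^(-ε))⁻¹` and flipped otherwise. -/
def randomizedResponse (ε : ℝ) : Kernel Bool Bool :=
  Kernel.ofFunOfCountable fun y => bernoulliMeasure y (!y) (unitInterval.sigmoid ε)

instance (ε : ℝ) : IsMarkovKernel (randomizedResponse ε) :=
  ⟨fun y => inferInstanceAs
    (IsProbabilityMeasure (bernoulliMeasure y (!y) (unitInterval.sigmoid ε)))⟩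

/-- The law of one sample `(s, (a⁰, a¹), y, ỹ)`: `s ∼ ρ`, `(a⁰, a¹) ∼ μ(· | s)`, `y` follows the BTL
model with parameter `θ`, and `ỹ` is the output of randomized response on `y`. -/
def sampleLaw (ρ : Measure S) (μ : Kernel S (A × A)) (φ : S → A → Vec d)
    (hφ : Measurable (Function.uncurry φ)) (θ : Vec d) (ε : ℝ) : Measure (Sample S A) :=
  ((ρ ⊗ₘ μ) ⊗ₘ labelKernel φ hφ θ) ⊗ₘ (randomizedResponse ε).prodMkLeft (Query S A)

/-- The population covariance matrix `Σ = 𝔼[x xᵀ]` of the differential feature. -/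
def featureCov (ρ : Measure S) (μ : Kernel S (A × A)) (φ : S → A → Vec d) :
    Matrix (Fin d) (Fin d) ℝ :=
  Matrix.of fun i j => ∫ q, diffFeature φ q i * diffFeature φ q j ∂(ρ ⊗ₘ μ)

lemma featureCov_isHermitian (ρ : Measure S) (μ : Kernel S (A × A)) (φ : S → A → Vec d) :
    (featureCov ρ μ φ).IsHermitian := by
  ext i j
  simp [featureCov, mul_comm]

end Model

/-- The smallest eigenvalue of a symmetric real matrix. -/
def lambdaMin {d : ℕ} (M : Matrix (Fin d) (Fin d) ℝ) (hM : M.IsHermitian) : ℝ :=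
  ⨅ i, hM.eigenvalues i

section Algorithm

variable {d : ℕ}

/-- The constraint set `Θ_B = {θ | ⟨1, θ⟩ = 0, ‖θ‖ ≤ B}`. -/
def paramSet (d : ℕ) (B : ℝ) : Set (Vec d) :=
  {θ | ∑ i, θ i = 0 ∧ ‖θ‖ ≤ B}

/-- Euclidean projection: the point of `K` nearest to `v`. -/
def euclideanProj (K : Set (Vec d)) (v : Vec d) : Vec d :=
  Classical.epsilon fun w => w ∈ K ∧ ∀ u ∈ K, ‖v - w‖ ≤ ‖v - u‖

/-- On the sets `Θ_B` with `B ≥ 0` the nearest point exists and is unique, so that the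
projection is that point. -/
lemma euclideanProj_eq_iff {B : ℝ} (hB : 0 ≤ B) (v w : Vec d) :
    euclideanProj (paramSet d B) v = w ↔
      w ∈ paramSet d B ∧ ∀ u ∈ paramSet d B, ‖v - w‖ ≤ ‖v - u‖ := by
  have hne : (paramSet d B).Nonempty := ⟨0, by simp [paramSet, hB]⟩
  have hcl : IsClosed (paramSet d B) := by
    refine IsClosed.inter (isClosed_eq (by fun_prop) continuous_const)
      (isClosed_le continuous_norm continuous_const)
  have hcv : Convex ℝ (paramSet d B) := by
    intro x hx y hy a b ha hb hab
    refine ⟨?_, ?_⟩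
    · simp [Finset.sum_add_distrib, ← Finset.mul_sum, hx.1, hy.1]
    · calc ‖a • x + b • y‖ ≤ ‖a • x‖ + ‖b • y‖ := norm_add_le _ _
        _ = a * ‖x‖ + b * ‖y‖ := by
          rw [norm_smul, norm_smul, Real.norm_of_nonneg ha, Real.norm_of_nonneg hb]
        _ ≤ a * B + b * B := by gcongr; exacts [hx.2, hy.2]
        _ = B := by rw [← add_mul, hab, one_mul]
  have key : ∀ w ∈ paramSet d B, (‖v - w‖ = ⨅ u : paramSet d B, ‖v - u‖) ↔
      ∀ u ∈ paramSet d B, ‖v - w‖ ≤ ‖v - u‖ := by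
    intro w hw
    have hbdd : BddBelow (Set.range fun u : paramSet d B => ‖v - u‖) :=
      ⟨0, by rintro _ ⟨u, rfl⟩; exact norm_nonneg _⟩
    have : Nonempty (paramSet d B) := hne.to_subtype
    constructor
    · intro h u hu
      rw [h]
      exact ciInf_le hbdd ⟨u, hu⟩
    · intro h
      exact le_antisymm (le_ciInf fun u => h u u.2) (ciInf_le hbdd ⟨w, hw⟩)
  have hex : ∃ w, w ∈ paramSet d B ∧ ∀ u ∈ paramSet d B, ‖v - w‖ ≤ ‖v - u‖ := by
    obtain ⟨w, hw, h⟩ := exists_norm_eq_iInf_of_complete_convex hne hcl.isComplete hcv v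
    exact ⟨w, hw, (key w hw).1 h⟩
  have hspec := Classical.epsilon_spec hex
  constructor
  · rintro rfl
    exact hspec
  · rintro ⟨hw, h⟩
    set p := euclideanProj (paramSet d B) v with hp
    have hpK : p ∈ paramSet d B := hspec.1
    have e1 := (norm_eq_iInf_iff_real_inner_le_zero hcv hpK).1 ((key p hpK).2 hspec.2) w hw
    have e2 := (norm_eq_iInf_iff_real_inner_le_zero hcv hw).1 ((key w hw).2 h) p hpK
    have e3 : inner ℝ (p - w) (p - w) ≤ 0 := by
      have : (inner ℝ (p - w) (p - w) : ℝ) = inner ℝ (v - w) (p - w) + inner ℝ (v - p) (w - p) := by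
        simp only [inner_sub_left, inner_sub_right]
        ring
      linarith
    rw [real_inner_self_eq_norm_sq] at e3
    exact sub_eq_zero.1 (norm_eq_zero.1 (pow_eq_zero_iff two_ne_zero |>.1 (le_antisymm e3 (sq_nonneg _))))

/-- The predicted score `p̂_y` of the randomized label `y` given the differential feature `x`:
`σ(xᵀθ)^σ(ε) / (1 - σ(xᵀθ))^(1 - σ(ε))` for `y = 1`, and
`(1 - σ(xᵀθ))^σ(ε) / σ(xᵀθ)^(1 - σ(ε))` for `y = 0`. -/
def score (ε : ℝ) (x : Vec d) (y : Bool) (θ : Vec d) : ℝ :=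
  let p := Real.sigmoid (inner ℝ x θ)
  let s := Real.sigmoid ε
  if y then p ^ s / (1 - p) ^ (1 - s) else (1 - p) ^ s / p ^ (1 - s)

/-- The de-biased stochastic gradient `ĝ = -∇_θ log p̂_ỹ`. -/
def gradEst (ε : ℝ) (x : Vec d) (y : Bool) (θ : Vec d) : Vec d :=
  -gradient (fun θ' => Real.log (score ε x y θ')) θ

/-- One-pass projected SGD on the features `x` and the randomized labels `y` with step sizes
`η 1, η 2, …`. Here `sgdIterate … t` is `θ̂_{t+1}`, the iterate after `t` updates (so
`sgdIterate … 0 = θ̂_1 = 0`), for `t ≤ n`; the `t`-th update uses the `t`-th data point, which has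
the index `t - 1` in `Fin n`. -/
def sgdIterate {n : ℕ} (ε B : ℝ) (η : ℕ → ℝ) (x : Fin n → Vec d) (y : Fin n → Bool) : ℕ → Vec d
  | 0 => 0
  | t + 1 =>
    let θ := sgdIterate ε B η x y t
    if h : t < n then
      euclideanProj (paramSet d B) (θ - η (t + 1) • gradEst ε (x ⟨t, h⟩) (y ⟨t, h⟩) θ)
    else θ

/-- The curvature parameter `γ = 1 / (2 + e^(-2LB) + e^(2LB))`. -/
def curvature (L B : ℝ) : ℝ :=
  1 / (2 + Real.exp (-2 * L * B) + Real.exp (2 * L * B))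

/-- The step size `η_t = 1 / (γ_ε κ t)` with `γ_ε = (2 σ(ε) - 1) γ`. -/
def stepSize (ε L B κ : ℝ) (t : ℕ) : ℝ :=
  1 / ((2 * Real.sigmoid ε - 1) * curvature L B * κ * t)

/-- The iterates `θ̂_{t+1}` computed from `n` samples, of which only the features
`x_i = φ(s_i, a¹_i) - φ(s_i, a⁰_i)` and the randomized labels are used. -/
def sgdRR {S A : Type*} {n : ℕ} (φ : S → A → Vec d) (ε L B κ : ℝ) (z : Fin n → Sample S A)
    (t : ℕ) : Vec d :=
  sgdIterate ε B (stepSize ε L B κ) (fun i => diffFeature φ (z i).1.1) (fun i => (z i).2) t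

end Algorithm

end PrivatePreference

end

open PrivatePreference

noncomputable section

namespace PrivatePreference

/-! ### The de-biased gradient, the projection onto `paramSet`, and the curvature of the logistic
link -/

section Gradient

variable {d : ℕ}

/-! Write `m = modulus ε L B κ` (that is, γ_ε κ) and D for the distance of the iterate to θ*. The
exponents in the score make the gradient equal to (`flipProb ε (σ(xᵀθ))` - ỹ) x. Since 𝔼[ỹ | x] =
`flipProb ε (σ(xᵀθ*))`, its mean is (2σ(ε) - 1) 𝔼[(σ(xᵀθ) - σ(xᵀθ*)) x], and curvature plus coverage
bound the mean of its correlation `gradGap` with θ - θ* below by m D².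

The noise is multiplicative: `gradGap` lies in [-2LD, 2LD], so Hoeffding's lemma gives it a variance
proxy proportional to D², which the contraction can absorb. For the scaled error V_t = (m/4L)² t D²
(`scaledError`) this yields 𝔼[exp V_{t+1} | past] ≤ exp((1 - 1/(2t)) V_t + 1/(4(t+1))).

This one inequality (`setLIntegral_exp_scaledError_succ_le`) is used twice. By convexity of exp it
propagates 𝔼 exp V_t ≤ e^{1/2} for every t. If the shrinkage is dropped, exp(V_t - (t-s)/(4s)) is a
supermartingale on [s, 2s] whose total drift correction is at most 1/4, so Ville's inequality
controls a whole dyadic block at the price of a constant. A union bound over the roughly log₂ n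
blocks produces the log log n. -/

lemma norm_diffFeature_le {S A : Type*} {φ : S → A → Vec d} {L : ℝ} (hL : ∀ s a, ‖φ s a‖ ≤ L)
    (q : Query S A) : ‖diffFeature φ q‖ ≤ 2 * L :=
  (norm_sub_le _ _).trans (by linarith [hL q.1 q.2.2, hL q.1 q.2.1])

lemma measurable_diffFeature {S A : Type*} [MeasurableSpace S] [MeasurableSpace A]
    {φ : S → A → Vec d} (hφ : Measurable (Function.uncurry φ)) :
    Measurable (diffFeature φ) := by
  have h : ∀ f : Query S A → A, Measurable f →
      Measurable (fun q : Query S A => φ q.1 (f q)) := fun f hf =>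
    hφ.comp (measurable_fst.prodMk hf)
  exact (h (fun q => q.2.2) (by fun_prop)).sub (h (fun q => q.2.1) (by fun_prop))

lemma coe_btlProb {S A : Type*} (φ : S → A → Vec d) (θ : Vec d) (q : Query S A) :
    (btlProb φ θ q : ℝ) = Real.sigmoid (inner ℝ (diffFeature φ q) θ) := by
  rw [Real.sigmoid_def, diffFeature, inner_sub_left]
  simp only [btlProb, reward, neg_sub, Real.exp_sub]
  field_simp
  ring

/-- The probability that randomized response outputs `1` on a label of law `Bernoulli p`. -/
def flipProb (ε p : ℝ) : ℝ :=
  Real.sigmoid ε * p + (1 - Real.sigmoid ε) * (1 - p)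

lemma flipProb_mem_Icc (ε : ℝ) {p : ℝ} (hp : p ∈ Set.Icc (0 : ℝ) 1) :
    flipProb ε p ∈ Set.Icc (0 : ℝ) 1 := by
  have h0 := Real.sigmoid_nonneg ε
  have h1 := Real.sigmoid_le_one ε
  unfold flipProb
  constructor
  · nlinarith [mul_nonneg h0 hp.1, mul_nonneg (sub_nonneg.2 h1) (sub_nonneg.2 hp.2)]
  · nlinarith [mul_nonneg h0 (sub_nonneg.2 hp.2), mul_nonneg (sub_nonneg.2 h1) hp.1]

/-- The derivative of `-log p̂_y` with respect to the margin `xᵀθ`. -/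
def lossDeriv (ε : ℝ) (y : Bool) (u : ℝ) : ℝ :=
  flipProb ε (Real.sigmoid u) - if y then 1 else 0

lemma sigmoid_mem_Icc (u : ℝ) : Real.sigmoid u ∈ Set.Icc (0 : ℝ) 1 :=
  ⟨Real.sigmoid_nonneg u, Real.sigmoid_le_one u⟩

lemma abs_lossDeriv_le (ε : ℝ) (y : Bool) (u : ℝ) : |lossDeriv ε y u| ≤ 1 := by
  have h := flipProb_mem_Icc ε (sigmoid_mem_Icc u)
  have h0 := h.1
  have h1 := h.2
  unfold lossDeriv
  rw [abs_le]
  cases y <;> constructor <;> simp <;> linarith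

lemma log_score (ε : ℝ) (x : Vec d) (y : Bool) (θ : Vec d) :
    Real.log (score ε x y θ) =
      if y then Real.sigmoid ε * Real.log (Real.sigmoid (inner ℝ x θ)) -
        (1 - Real.sigmoid ε) * Real.log (1 - Real.sigmoid (inner ℝ x θ))
      else Real.sigmoid ε * Real.log (1 - Real.sigmoid (inner ℝ x θ)) -
        (1 - Real.sigmoid ε) * Real.log (Real.sigmoid (inner ℝ x θ)) := by
  have h0 := Real.sigmoid_pos (inner ℝ x θ)
  have h1 : 0 < 1 - Real.sigmoid (inner ℝ x θ) := sub_pos.2 (Real.sigmoid_lt_one _)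
  cases y
  · simp only [score, Bool.false_eq_true, if_false]
    rw [Real.log_div (Real.rpow_pos_of_pos h1 _).ne' (Real.rpow_pos_of_pos h0 _).ne',
      Real.log_rpow h1, Real.log_rpow h0]
  · simp only [score, if_true]
    rw [Real.log_div (Real.rpow_pos_of_pos h0 _).ne' (Real.rpow_pos_of_pos h1 _).ne',
      Real.log_rpow h1, Real.log_rpow h0]

/-- The score divides by the power `1 - σ(ε)` instead of multiplying, so that the two logarithmic
derivatives combine into the residual of the flipped label. This is what centres the gradient at θ*.
-/
lemma gradEst_eq (ε : ℝ) (x : Vec d) (y : Bool) (θ : Vec d) :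
    gradEst ε x y θ = lossDeriv ε y (inner ℝ x θ) • x := by
  have h0 := Real.sigmoid_pos (inner ℝ x θ)
  have h1 : 0 < 1 - Real.sigmoid (inner ℝ x θ) := sub_pos.2 (Real.sigmoid_lt_one _)
  have hs := Real.hasDerivAt_sigmoid (inner ℝ x θ)
  have hl0 : HasDerivAt (fun u => Real.log (Real.sigmoid u))
      (1 - Real.sigmoid (inner ℝ x θ)) (inner ℝ x θ) := by
    convert hs.log h0.ne' using 1
    field_simp
  have hl1 : HasDerivAt (fun u => Real.log (1 - Real.sigmoid u))
      (-Real.sigmoid (inner ℝ x θ)) (inner ℝ x θ) := by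
    convert (hs.const_sub 1).log h1.ne' using 1
    field_simp
  have hd : HasDerivAt (fun u => if y then Real.sigmoid ε * Real.log (Real.sigmoid u) -
        (1 - Real.sigmoid ε) * Real.log (1 - Real.sigmoid u)
      else Real.sigmoid ε * Real.log (1 - Real.sigmoid u) -
        (1 - Real.sigmoid ε) * Real.log (Real.sigmoid u))
      (-lossDeriv ε y (inner ℝ x θ)) (inner ℝ x θ) := by
    cases y
    · simp only [Bool.false_eq_true, if_false]
      refine ((hl1.const_mul (Real.sigmoid ε)).sub
        (hl0.const_mul (1 - Real.sigmoid ε))).congr_deriv ?_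
      simp [lossDeriv, flipProb]
      ring
    · simp only [if_true]
      refine ((hl0.const_mul (Real.sigmoid ε)).sub
        (hl1.const_mul (1 - Real.sigmoid ε))).congr_deriv ?_
      simp [lossDeriv, flipProb]
      ring
  have hi : HasFDerivAt (fun θ' : Vec d => (inner ℝ x θ' : ℝ)) (innerSL ℝ x) θ :=
    (innerSL ℝ x).hasFDerivAt
  have hg : HasGradientAt (fun θ' => Real.log (score ε x y θ'))
      (-lossDeriv ε y (inner ℝ x θ) • x) θ := by
    simp only [log_score]
    rw [hasGradientAt_iff_hasFDerivAt]
    refine (hd.comp_hasFDerivAt θ hi).congr_fderiv ?_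
    ext v
    simp
  rw [gradEst, hg.gradient, neg_smul, neg_neg]

lemma norm_gradEst_le (ε : ℝ) (x : Vec d) (y : Bool) (θ : Vec d) :
    ‖gradEst ε x y θ‖ ≤ ‖x‖ := by
  rw [gradEst_eq, norm_smul, Real.norm_eq_abs]
  exact mul_le_of_le_one_left (norm_nonneg _) (abs_lossDeriv_le _ _ _)

lemma measurable_lossDeriv (ε : ℝ) :
    Measurable (fun p : Bool × ℝ => lossDeriv ε p.1 p.2) := by
  have h := continuous_sigmoid.measurable
  unfold lossDeriv flipProb
  refine Measurable.sub (by fun_prop) (Measurable.ite ?_ measurable_const measurable_const)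
  exact measurable_fst (measurableSet_singleton true)

lemma measurable_gradEst (ε : ℝ) :
    Measurable (fun p : (Vec d × Bool) × Vec d => gradEst ε p.1.1 p.1.2 p.2) := by
  simp only [gradEst_eq]
  have h : Measurable (fun p : (Vec d × Bool) × Vec d => (p.1.2, (inner ℝ p.1.1 p.2 : ℝ))) := by
    fun_prop
  exact ((measurable_lossDeriv ε).comp h).smul (by fun_prop)

lemma convex_paramSet (B : ℝ) : Convex ℝ (paramSet d B) := by
  have h1 : Convex ℝ {θ : Vec d | ∑ i, θ i = 0} := by
    intro x hx y hy a b _ _ _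
    simp only [Set.mem_ofPred_eq] at hx hy
    simp [Finset.sum_add_distrib, ← Finset.mul_sum, hx, hy]
  have h2 : Convex ℝ {θ : Vec d | ‖θ‖ ≤ B} := by
    simpa [Metric.closedBall, dist_zero_right] using convex_closedBall (0 : Vec d) B
  exact h1.inter h2

lemma euclideanProj_mem {B : ℝ} (hB : 0 ≤ B) (v : Vec d) :
    euclideanProj (paramSet d B) v ∈ paramSet d B :=
  ((euclideanProj_eq_iff hB v _).1 rfl).1

lemma inner_sub_euclideanProj_nonpos {B : ℝ} (hB : 0 ≤ B) (v : Vec d) {u : Vec d}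
    (hu : u ∈ paramSet d B) :
    inner ℝ (v - euclideanProj (paramSet d B) v) (u - euclideanProj (paramSet d B) v) ≤ 0 := by
  obtain ⟨hw, h⟩ := (euclideanProj_eq_iff hB v _).1 rfl
  refine (norm_eq_iInf_iff_real_inner_le_zero (convex_paramSet B) hw).1 ?_ u hu
  have : Nonempty (paramSet d B) := ⟨⟨u, hu⟩⟩
  refine le_antisymm (le_ciInf fun u => h u u.2) (ciInf_le (f := fun u : paramSet d B => ‖v - u‖)
    ⟨0, ?_⟩ ⟨_, hw⟩)
  rintro _ ⟨u, rfl⟩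
  exact norm_nonneg _

/-- Adding the variational inequalities at the two projected points gives ‖p - q‖² ≤ ⟨v - w, p - q⟩;
Cauchy–Schwarz finishes. -/
lemma norm_euclideanProj_sub_euclideanProj_le {B : ℝ} (hB : 0 ≤ B) (v w : Vec d) :
    ‖euclideanProj (paramSet d B) v - euclideanProj (paramSet d B) w‖ ≤ ‖v - w‖ := by
  set p := euclideanProj (paramSet d B) v with hp
  set q := euclideanProj (paramSet d B) w with hq
  have h1 := inner_sub_euclideanProj_nonpos hB v (euclideanProj_mem hB w)
  have h2 := inner_sub_euclideanProj_nonpos hB w (euclideanProj_mem hB v)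
  rw [← hp, ← hq] at h1 h2
  have h3 : ‖p - q‖ ^ 2 ≤ inner ℝ (v - w) (p - q) := by
    rw [← real_inner_self_eq_norm_sq]
    have : (inner ℝ (v - w) (p - q) : ℝ) - inner ℝ (p - q) (p - q) =
        -(inner ℝ (v - p) (q - p)) - inner ℝ (w - q) (p - q) := by
      simp only [inner_sub_left, inner_sub_right]
      ring
    linarith
  have h4 := real_inner_le_norm (v - w) (p - q)
  by_contra! h
  nlinarith [norm_nonneg (v - w), norm_nonneg (p - q)]

lemma euclideanProj_of_mem {B : ℝ} (hB : 0 ≤ B) {v : Vec d} (hv : v ∈ paramSet d B) :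
    euclideanProj (paramSet d B) v = v :=
  (euclideanProj_eq_iff hB v v).2 ⟨hv, fun u _ => by simp⟩

lemma norm_euclideanProj_sub_le {B : ℝ} (hB : 0 ≤ B) (v : Vec d) {u : Vec d}
    (hu : u ∈ paramSet d B) : ‖euclideanProj (paramSet d B) v - u‖ ≤ ‖v - u‖ := by
  simpa [euclideanProj_of_mem hB hu] using norm_euclideanProj_sub_euclideanProj_le hB v u

/-- The projection is defined by a choice operator, so measurability is drawn from its Lipschitz
continuity. -/
lemma measurable_euclideanProj {B : ℝ} (hB : 0 ≤ B) :
    Measurable (euclideanProj (paramSet d B)) := by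
  have : LipschitzWith 1 (euclideanProj (paramSet d B)) := by
    refine LipschitzWith.of_dist_le_mul fun v w => ?_
    simpa [dist_eq_norm] using norm_euclideanProj_sub_euclideanProj_le hB v w
  exact this.continuous.measurable

lemma mul_norm_sq_le_of_le_lambdaMin {M : Matrix (Fin d) (Fin d) ℝ} (hM : M.IsHermitian) {κ : ℝ}
    (h : κ ≤ lambdaMin M hM) (v : Vec d) :
    κ * ‖v‖ ^ 2 ≤ ∑ i, ∑ j, M i j * (v i * v j) := by
  have hev : ∀ i, κ ≤ hM.eigenvalues i := fun i => h.trans (ciInf_le (Finite.bddBelow_range _) i)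
  have hquad : ∑ i, ∑ j, M i j * (v i * v j) = inner ℝ v (Matrix.toEuclideanLin M v) := by
    simp [PiLp.inner_apply, Matrix.toLpLin_apply, Matrix.mulVec, dotProduct,
      Finset.sum_mul]
    exact Finset.sum_congr rfl fun i _ => Finset.sum_congr rfl fun j _ => by ring
  have hb : ∀ i, Matrix.toEuclideanLin M (hM.eigenvectorBasis i) =
      hM.eigenvalues i • hM.eigenvectorBasis i := by
    intro i
    rw [Matrix.toLpLin_apply, hM.mulVec_eigenvectorBasis]
    rfl
  have hsym : ∀ i, inner ℝ (hM.eigenvectorBasis i) (Matrix.toEuclideanLin M v) =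
      hM.eigenvalues i * inner ℝ (hM.eigenvectorBasis i) v := by
    intro i
    have := (Matrix.isSymmetric_toEuclideanLin_iff.2 hM) (hM.eigenvectorBasis i) v
    rw [← this, hb, real_inner_smul_left]
  -- In the eigenbasis both sides become weighted sums of squared coordinates, compared term by
  -- term.
  rw [hquad, ← hM.eigenvectorBasis.sum_inner_mul_inner, ← hM.eigenvectorBasis.sum_sq_norm_inner_right,
    Finset.mul_sum]
  refine Finset.sum_le_sum fun i _ => ?_
  rw [hsym, Real.norm_eq_abs, sq_abs, real_inner_comm v]
  nlinarith [hev i, sq_nonneg (inner ℝ (hM.eigenvectorBasis i) v : ℝ)]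

lemma curvature_pos (L B : ℝ) : 0 < curvature L B := by
  unfold curvature
  positivity

/-- The slope σ(1 - σ) at u is 1/(2 + e^{-u} + e^u) = 1/(2 + 2 cosh u), which decreases in |u|;
`curvature` is its value at the extreme margin 2LB. -/
lemma curvature_le_sigmoid_mul {L B u : ℝ} (hu : |u| ≤ 2 * L * B) :
    curvature L B ≤ Real.sigmoid u * (1 - Real.sigmoid u) := by
  have hs : Real.sigmoid u * (1 - Real.sigmoid u) = 1 / (2 + Real.exp (-u) + Real.exp u) := by
    rw [Real.sigmoid_def, Real.exp_neg]
    have := Real.exp_pos u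
    field_simp
    ring
  have hcosh : Real.cosh u ≤ Real.cosh (2 * L * B) :=
    Real.cosh_le_cosh.2 (hu.trans (le_abs_self _))
  rw [Real.cosh_eq, Real.cosh_eq] at hcosh
  rw [hs, curvature, show -2 * L * B = -(2 * L * B) by ring]
  refine one_div_le_one_div_of_le (by positivity) ?_
  linarith

lemma curvature_mul_sq_le {L B u v : ℝ} (hu : |u| ≤ 2 * L * B) (hv : |v| ≤ 2 * L * B) :
    curvature L B * (u - v) ^ 2 ≤ (Real.sigmoid u - Real.sigmoid v) * (u - v) := by
  have key : ∀ u v : ℝ, |u| ≤ 2 * L * B → |v| ≤ 2 * L * B → v ≤ u →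
      curvature L B * (u - v) ≤ Real.sigmoid u - Real.sigmoid v := by
    intro u v hu hv huv
    rw [abs_le] at hu hv
    refine (convex_Icc (-(2 * L * B)) (2 * L * B)).mul_sub_le_image_sub_of_le_deriv
      continuous_sigmoid.continuousOn differentiable_sigmoid.differentiableOn ?_ v hv u hu huv
    intro w hw
    rw [interior_Icc] at hw
    rw [Real.deriv_sigmoid]
    exact curvature_le_sigmoid_mul (abs_le.2 ⟨hw.1.le, hw.2.le⟩)
  rcases le_total v u with h | h
  · nlinarith [key u v hu hv h]
  · nlinarith [key v u hv hu h]

end Gradient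

/-! ### Deterministic recursion for one projected step -/

section Step

variable {S A : Type*} {d : ℕ} {φ : S → A → Vec d}

lemma abs_inner_diffFeature_le {L B : ℝ} (hL : ∀ s a, ‖φ s a‖ ≤ L) {θ : Vec d}
    (hθ : ‖θ‖ ≤ B) (q : Query S A) : |inner ℝ (diffFeature φ q) θ| ≤ 2 * L * B :=
  (abs_real_inner_le_norm _ _).trans (mul_le_mul (norm_diffFeature_le hL q) hθ (norm_nonneg _)
    ((norm_nonneg _).trans (norm_diffFeature_le hL q)))

/-- The correlation of the stochastic gradient at `θ` with `θ - θ*`. -/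
def gradGap (φ : S → A → Vec d) (ε : ℝ) (θ θstar : Vec d) (z : Sample S A) : ℝ :=
  inner ℝ (gradEst ε (diffFeature φ z.1.1) z.2 θ) (θ - θstar)

lemma abs_gradGap_le {L : ℝ} (hL : ∀ s a, ‖φ s a‖ ≤ L) (ε : ℝ) (θ θstar : Vec d)
    (z : Sample S A) : |gradGap φ ε θ θstar z| ≤ 2 * L * ‖θ - θstar‖ :=
  (abs_real_inner_le_norm _ _).trans (mul_le_mul_of_nonneg_right
    ((norm_gradEst_le _ _ _ _).trans (norm_diffFeature_le hL _)) (norm_nonneg _))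

/-- One step of projected SGD. -/
def sgdStep (φ : S → A → Vec d) (ε B η : ℝ) (θ : Vec d) (z : Sample S A) : Vec d :=
  euclideanProj (paramSet d B) (θ - η • gradEst ε (diffFeature φ z.1.1) z.2 θ)

lemma norm_sgdStep_sub_sq_le {L B : ℝ} (hB : 0 ≤ B) (hL : ∀ s a, ‖φ s a‖ ≤ L) {ε η : ℝ}
    {θ θstar : Vec d} (hθstar : θstar ∈ paramSet d B) (z : Sample S A) :
    ‖sgdStep φ ε B η θ z - θstar‖ ^ 2 ≤
      ‖θ - θstar‖ ^ 2 - 2 * η * gradGap φ ε θ θstar z + η ^ 2 * (2 * L) ^ 2 := by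
  set g := gradEst ε (diffFeature φ z.1.1) z.2 θ with hg
  have h1 := norm_euclideanProj_sub_le hB (θ - η • g) hθstar
  have h2 : ‖g‖ ≤ 2 * L := (norm_gradEst_le _ _ _ _).trans (norm_diffFeature_le hL _)
  calc ‖sgdStep φ ε B η θ z - θstar‖ ^ 2 ≤ ‖θ - η • g - θstar‖ ^ 2 := by
        exact pow_le_pow_left₀ (norm_nonneg _) h1 2
    _ = ‖θ - θstar‖ ^ 2 - 2 * η * inner ℝ g (θ - θstar) + η ^ 2 * ‖g‖ ^ 2 := by
        rw [show θ - η • g - θstar = (θ - θstar) - η • g by abel, norm_sub_sq_real,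
          real_inner_smul_right, norm_smul, real_inner_comm, mul_pow, Real.norm_eq_abs, sq_abs]
        ring
    _ ≤ _ := by
        rw [gradGap]
        gcongr

end Step

/-! ### Strong monotonicity in mean and exponential moments of one step -/

section Moments

variable {S A : Type*} {d : ℕ} [MeasurableSpace S] [MeasurableSpace A]
  {ρ : Measure S} [IsProbabilityMeasure ρ] {μ : Kernel S (A × A)} [IsMarkovKernel μ]
  {φ : S → A → Vec d} {hφ : Measurable (Function.uncurry φ)}

instance (θ : Vec d) (ε : ℝ) : IsProbabilityMeasure (sampleLaw ρ μ φ hφ θ ε) := by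
  unfold sampleLaw
  infer_instance

lemma integral_sampleLaw (θ : Vec d) (ε : ℝ) {f : Query S A × Bool → ℝ} (hf : Measurable f)
    {K : ℝ} (hK : ∀ p, |f p| ≤ K) :
    ∫ z, f (z.1.1, z.2) ∂(sampleLaw ρ μ φ hφ θ ε) =
      ∫ q, (flipProb ε (btlProb φ θ q) * f (q, true) +
        (1 - flipProb ε (btlProb φ θ q)) * f (q, false)) ∂(ρ ⊗ₘ μ) := by
  have hint : ∀ {X : Type _} [MeasurableSpace X] (ν : Measure X) [IsProbabilityMeasure ν]
      (g : X → ℝ), Measurable g → (∀ p, |g p| ≤ K) → Integrable g ν :=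
    fun ν _ g hg h => Integrable.of_bound hg.aestronglyMeasurable K (.of_forall h)
  rw [sampleLaw, Measure.integral_compProd (hint _ _ (by fun_prop) fun z => hK _)]
  have h1 : ∀ w : Query S A × Bool,
      ∫ y, f (w.1, y) ∂((randomizedResponse ε).prodMkLeft (Query S A) w) =
        Real.sigmoid ε * f (w.1, w.2) + (1 - Real.sigmoid ε) * f (w.1, !w.2) := by
    intro w
    rw [Kernel.prodMkLeft_apply]
    change ∫ y, f (w.1, y) ∂(bernoulliMeasure w.2 (!w.2) (unitInterval.sigmoid ε)) = _
    rw [integral_bernoulliMeasure]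
    rfl
  simp only [h1]
  have hb : ∀ w : Query S A × Bool,
      |Real.sigmoid ε * f (w.1, w.2) + (1 - Real.sigmoid ε) * f (w.1, !w.2)| ≤ K := by
    intro w
    have h0 := Real.sigmoid_nonneg ε
    have h1 := Real.sigmoid_le_one ε
    have ha := abs_le.1 (hK (w.1, w.2))
    have hb := abs_le.1 (hK (w.1, !w.2))
    rw [abs_le]
    constructor <;> nlinarith
  have hm : Measurable fun w : Query S A × Bool =>
      Real.sigmoid ε * f (w.1, w.2) + (1 - Real.sigmoid ε) * f (w.1, !w.2) := by
    have : Measurable fun w : Query S A × Bool => (w.1, !w.2) :=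
      measurable_fst.prodMk ((measurable_of_finite Bool.not).comp measurable_snd)
    have := hf.comp this
    fun_prop
  rw [Measure.integral_compProd (hint _ _ hm hb)]
  refine integral_congr_ae (.of_forall fun q => ?_)
  change ∫ y, _ ∂(bernoulliMeasure true false (btlProb φ θ q)) = _
  rw [integral_bernoulliMeasure]
  simp [flipProb]
  ring

lemma integrable_mul_diffFeature {L : ℝ} (hφ : Measurable (Function.uncurry φ))
    (hL : ∀ s a, ‖φ s a‖ ≤ L) (i j : Fin d) :
    Integrable (fun q => diffFeature φ q i * diffFeature φ q j) (ρ ⊗ₘ μ) := by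
  have hm := measurable_diffFeature hφ
  refine Integrable.of_bound (Measurable.aestronglyMeasurable (by fun_prop))
    ((2 * L) * (2 * L)) (.of_forall fun q => ?_)
  have h : ∀ i, ‖diffFeature φ q i‖ ≤ 2 * L := fun i =>
    (PiLp.norm_apply_le _ i).trans (norm_diffFeature_le hL q)
  rw [norm_mul]
  exact mul_le_mul (h i) (h j) (norm_nonneg _) ((norm_nonneg _).trans (h i))

lemma mul_norm_sq_le_integral_inner_sq {L κ : ℝ} (hφ : Measurable (Function.uncurry φ))
    (hL : ∀ s a, ‖φ s a‖ ≤ L)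
    (hκ : κ ≤ lambdaMin (featureCov ρ μ φ) (featureCov_isHermitian ρ μ φ)) (v : Vec d) :
    κ * ‖v‖ ^ 2 ≤ ∫ q, (inner ℝ (diffFeature φ q) v) ^ 2 ∂(ρ ⊗ₘ μ) := by
  refine (mul_norm_sq_le_of_le_lambdaMin _ hκ v).trans_eq ?_
  have hint := integrable_mul_diffFeature (ρ := ρ) (μ := μ) hφ hL
  have : ∀ q, (inner ℝ (diffFeature φ q) v : ℝ) ^ 2 =
      ∑ i, ∑ j, diffFeature φ q i * diffFeature φ q j * (v i * v j) := by
    intro q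
    simp only [PiLp.inner_apply, sq, Finset.sum_mul_sum]
    refine Finset.sum_congr rfl fun i _ => Finset.sum_congr rfl fun j _ => ?_
    simp
    ring
  simp only [this]
  rw [integral_finsetSum _ fun i _ => integrable_finsetSum _ fun j _ => (hint i j).mul_const _]
  refine Finset.sum_congr rfl fun i _ => ?_
  rw [integral_finsetSum _ fun j _ => (hint i j).mul_const _]
  refine Finset.sum_congr rfl fun j _ => ?_
  rw [integral_mul_const]
  rfl

/-- The strong convexity constant `γ_ε κ` of the population loss. -/
def modulus (ε L B κ : ℝ) : ℝ :=
  (2 * Real.sigmoid ε - 1) * curvature L B * κ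

lemma measurable_gradGap (hφ : Measurable (Function.uncurry φ)) (ε : ℝ) (θ θstar : Vec d) :
    Measurable (gradGap φ ε θ θstar) := by
  have hm := measurable_diffFeature hφ
  have : Measurable fun z : Sample S A => ((diffFeature φ z.1.1, z.2), θ) := by fun_prop
  have := (measurable_gradEst ε).comp this
  exact this.inner measurable_const

lemma modulus_mul_norm_sq_le_integral_gradGap {L B κ ε : ℝ} {θ θstar : Vec d}
    (hL : ∀ s a, ‖φ s a‖ ≤ L) (hε : 0 < ε)
    (hκ : κ ≤ lambdaMin (featureCov ρ μ φ) (featureCov_isHermitian ρ μ φ))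
    (hθ : ‖θ‖ ≤ B) (hθstar : ‖θstar‖ ≤ B) :
    modulus ε L B κ * ‖θ - θstar‖ ^ 2 ≤
      ∫ z, gradGap φ ε θ θstar z ∂(sampleLaw ρ μ φ hφ θstar ε) := by
  have hs : 0 < 2 * Real.sigmoid ε - 1 := by
    have := Real.sigmoid_lt hε
    rw [Real.sigmoid_zero] at this
    linarith
  have hm := measurable_diffFeature hφ
  have hx : ∀ q, (inner ℝ (diffFeature φ q) (θ - θstar) : ℝ) =
      inner ℝ (diffFeature φ q) θ - inner ℝ (diffFeature φ q) θstar := fun q => inner_sub_right _ _ _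
  have hf : Measurable fun p : Query S A × Bool =>
      (inner ℝ (gradEst ε (diffFeature φ p.1) p.2 θ) (θ - θstar) : ℝ) := by
    have : Measurable fun p : Query S A × Bool => ((diffFeature φ p.1, p.2), θ) := by fun_prop
    exact ((measurable_gradEst ε).comp this).inner measurable_const
  have hfb : ∀ p : Query S A × Bool,
      |(inner ℝ (gradEst ε (diffFeature φ p.1) p.2 θ) (θ - θstar) : ℝ)| ≤ 2 * L * ‖θ - θstar‖ :=
    fun p => abs_gradGap_le hL ε θ θstar ((p.1, p.2), p.2)
  have h := integral_sampleLaw (ρ := ρ) (μ := μ) (hφ := hφ) θstar ε hf hfb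
  have hcs := continuous_sigmoid.measurable
  calc modulus ε L B κ * ‖θ - θstar‖ ^ 2
      = (2 * Real.sigmoid ε - 1) * curvature L B * (κ * ‖θ - θstar‖ ^ 2) := by
        rw [modulus]; ring
    _ ≤ (2 * Real.sigmoid ε - 1) * curvature L B *
          ∫ q, (inner ℝ (diffFeature φ q) (θ - θstar)) ^ 2 ∂(ρ ⊗ₘ μ) := by
        have := curvature_pos L B
        gcongr
        exact mul_norm_sq_le_integral_inner_sq hφ hL hκ _
    _ = ∫ q, (2 * Real.sigmoid ε - 1) * (curvature L B *
          (inner ℝ (diffFeature φ q) (θ - θstar)) ^ 2) ∂(ρ ⊗ₘ μ) := by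
        rw [← integral_const_mul]
        simp only [mul_assoc]
    _ ≤ ∫ q, (2 * Real.sigmoid ε - 1) * ((Real.sigmoid (inner ℝ (diffFeature φ q) θ) -
          Real.sigmoid (inner ℝ (diffFeature φ q) θstar)) *
            inner ℝ (diffFeature φ q) (θ - θstar)) ∂(ρ ⊗ₘ μ) := by
        have hb1 := fun q => abs_inner_diffFeature_le (B := B) hL hθ q
        have hb2 := fun q => abs_inner_diffFeature_le (B := B) hL hθstar q
        have hle : ∀ q, curvature L B * (inner ℝ (diffFeature φ q) (θ - θstar)) ^ 2 ≤
            (Real.sigmoid (inner ℝ (diffFeature φ q) θ) -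
              Real.sigmoid (inner ℝ (diffFeature φ q) θstar)) *
                inner ℝ (diffFeature φ q) (θ - θstar) := by
          intro q
          rw [hx]
          exact curvature_mul_sq_le (hb1 q) (hb2 q)
        have hx2 := fun q => abs_inner_diffFeature_le (B := ‖θ - θstar‖) hL le_rfl q
        refine integral_mono_of_nonneg (.of_forall fun q => ?_) ?_ (.of_forall fun q => ?_)
        · have := curvature_pos L B
          positivity
        · refine Integrable.const_mul (Integrable.of_bound
            (Measurable.aestronglyMeasurable (by fun_prop)) (1 * (2 * L * ‖θ - θstar‖))
              (.of_forall fun q => ?_)) _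
          rw [norm_mul]
          refine mul_le_mul ?_ (hx2 q) (norm_nonneg _) zero_le_one
          have h1 := sigmoid_mem_Icc (inner ℝ (diffFeature φ q) θ)
          have h2 := sigmoid_mem_Icc (inner ℝ (diffFeature φ q) θstar)
          rw [Real.norm_eq_abs, abs_le]
          constructor <;> linarith [h1.1, h1.2, h2.1, h2.2]
        · exact mul_le_mul_of_nonneg_left (hle q) hs.le
    _ = ∫ z, gradGap φ ε θ θstar z ∂(sampleLaw ρ μ φ hφ θstar ε) := by
        unfold gradGap
        rw [h]
        refine integral_congr_ae (.of_forall fun q => ?_)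
        simp only [gradEst_eq, real_inner_smul_left, coe_btlProb, lossDeriv, if_true,
          Bool.false_eq_true, if_false, flipProb]
        ring

/-- The mean of `gradGap` lies between m D² and 2LD. The resulting a priori bound on D does not
involve B; it starts the induction on exponential moments. -/
lemma norm_sub_mul_modulus_le {L B κ ε : ℝ} {θ θstar : Vec d} (hφ : Measurable (Function.uncurry φ))
    (hL : ∀ s a, ‖φ s a‖ ≤ L) (hε : 0 < ε)
    (hκ : κ ≤ lambdaMin (featureCov ρ μ φ) (featureCov_isHermitian ρ μ φ))
    (hθ : ‖θ‖ ≤ B) (hθstar : ‖θstar‖ ≤ B) (hL0 : 0 ≤ L) :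
    modulus ε L B κ * ‖θ - θstar‖ ≤ 2 * L := by
  have h := modulus_mul_norm_sq_le_integral_gradGap (hφ := hφ) hL hε hκ hθ hθstar
  have h2 : ∫ z, gradGap φ ε θ θstar z ∂(sampleLaw ρ μ φ hφ θstar ε) ≤ 2 * L * ‖θ - θstar‖ := by
    have := norm_integral_le_of_norm_le_const (μ := sampleLaw ρ μ φ hφ θstar ε)
      (f := gradGap φ ε θ θstar)
      (.of_forall fun z => abs_gradGap_le hL ε θ θstar z)
    rw [probReal_univ, mul_one] at this
    exact (le_abs_self _).trans this
  rcases (norm_nonneg (θ - θstar)).eq_or_lt with h0 | h0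
  · rw [← h0]
    linarith
  · exact le_of_mul_le_mul_right (by nlinarith) h0

/-- Hoeffding's lemma on an interval of half-length R = 2L‖θ - θ*‖, with the mean replaced by its
lower bound. The price R² s²/2 is of the same order in ‖θ - θ*‖ as the gain. -/
lemma lintegral_exp_neg_gradGap_le {L B κ ε s : ℝ} {θ θstar : Vec d}
    (hL : ∀ s a, ‖φ s a‖ ≤ L) (hε : 0 < ε)
    (hκ : κ ≤ lambdaMin (featureCov ρ μ φ) (featureCov_isHermitian ρ μ φ))
    (hθ : ‖θ‖ ≤ B) (hθstar : ‖θstar‖ ≤ B) (hL0 : 0 ≤ L) (hs : 0 ≤ s) :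
    ∫⁻ z, ENNReal.ofReal (Real.exp (-(s * gradGap φ ε θ θstar z)))
        ∂(sampleLaw ρ μ φ hφ θstar ε) ≤
      ENNReal.ofReal (Real.exp (-(s * (modulus ε L B κ * ‖θ - θstar‖ ^ 2)) +
        2 * L ^ 2 * s ^ 2 * ‖θ - θstar‖ ^ 2)) := by
  set ν := sampleLaw ρ μ φ hφ θstar ε
  set R := 2 * L * ‖θ - θstar‖
  have hR : 0 ≤ R := by positivity
  have hm := measurable_gradGap hφ ε θ θstar
  have hmem : ∀ᵐ z ∂ν, gradGap φ ε θ θstar z ∈ Set.Icc (-R) R :=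
    .of_forall fun z => abs_le.1 (abs_gradGap_le hL ε θ θstar z)
  have hsg := hasSubgaussianMGF_of_mem_Icc hm.aemeasurable hmem
  have hint := integrable_exp_mul_of_mem_Icc (t := -s) hm.aemeasurable hmem
  have hmgf := hsg.mgf_le (-s)
  rw [mgf] at hmgf
  simp only [mul_sub, Real.exp_sub] at hmgf
  rw [integral_div, div_le_iff₀ (Real.exp_pos _), ← Real.exp_add] at hmgf
  have hc : (((‖R - -R‖₊ / 2) ^ 2 : NNReal) : ℝ) = R ^ 2 := by
    rw [NNReal.coe_pow, NNReal.coe_div, coe_nnnorm, Real.norm_eq_abs, abs_of_nonneg (by linarith)]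
    simp
  rw [hc] at hmgf
  have hlow := modulus_mul_norm_sq_le_integral_gradGap (hφ := hφ) hL hε hκ hθ hθstar
  rw [← ofReal_integral_eq_lintegral_ofReal (by simpa only [neg_mul] using hint)
    (.of_forall fun z => (Real.exp_pos _).le)]
  refine ENNReal.ofReal_le_ofReal ?_
  simp only [neg_mul] at hmgf
  refine hmgf.trans (Real.exp_le_exp.2 ?_)
  have := mul_le_mul_of_nonneg_left hlow hs
  have e : R ^ 2 * (-s) ^ 2 / 2 = 2 * L ^ 2 * s ^ 2 * ‖θ - θstar‖ ^ 2 := by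
    simp only [R]; ring
  rw [e]
  linarith

lemma measurable_sgdStep (hφ : Measurable (Function.uncurry φ)) (ε η : ℝ) {B : ℝ} (hB : 0 ≤ B) :
    Measurable (Function.uncurry (sgdStep φ ε B η)) := by
  have hm := measurable_diffFeature hφ
  have : Measurable fun p : Vec d × Sample S A => ((diffFeature φ p.2.1.1, p.2.2), p.1) := by
    fun_prop
  have := (measurable_gradEst ε).comp this
  exact (measurable_euclideanProj hB).comp (measurable_fst.sub (this.const_smul η))

/-- The exponential moment of one SGD step, on the scale on which `t ‖θ_t - θ*‖²` is of order `1`. -/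
lemma lintegral_exp_sgdStep_le {L B κ ε : ℝ} {θ θstar : Vec d}
    (hL : ∀ s a, ‖φ s a‖ ≤ L) (hε : 0 < ε)
    (hκ : κ ≤ lambdaMin (featureCov ρ μ φ) (featureCov_isHermitian ρ μ φ))
    (hθ : θ ∈ paramSet d B) (hθstar : θstar ∈ paramSet d B) (hL0 : 0 < L)
    (hmod : 0 < modulus ε L B κ) {t : ℝ} (ht : 0 < t) :
    ∫⁻ z, ENNReal.ofReal (Real.exp ((modulus ε L B κ / (4 * L)) ^ 2 * (t *
        ‖sgdStep φ ε B (1 / (modulus ε L B κ * t)) θ z - θstar‖ ^ 2)))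
        ∂(sampleLaw ρ μ φ hφ θstar ε) ≤
      ENNReal.ofReal (Real.exp ((modulus ε L B κ / (4 * L)) ^ 2 *
        ((t - 3 / 2) * ‖θ - θstar‖ ^ 2) + 1 / (4 * t))) := by
  set m := modulus ε L B κ
  set c := (m / (4 * L)) ^ 2 with hc
  have hB : 0 ≤ B := (norm_nonneg _).trans hθ.2
  -- The coefficient of `gradGap` in the exponent: the step size 1/(mt) turns c · t · 2η into 2c/m.
  have hs : 0 ≤ 2 * c / m := by positivity
  have hpt : ∀ z, ENNReal.ofReal (Real.exp (c * (t *
      ‖sgdStep φ ε B (1 / (m * t)) θ z - θstar‖ ^ 2))) ≤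
      ENNReal.ofReal (Real.exp (c * (t * ‖θ - θstar‖ ^ 2) + 1 / (4 * t))) *
        ENNReal.ofReal (Real.exp (-(2 * c / m * gradGap φ ε θ θstar z))) := by
    intro z
    rw [← ENNReal.ofReal_mul (Real.exp_pos _).le, ← Real.exp_add]
    refine ENNReal.ofReal_le_ofReal (Real.exp_le_exp.2 ?_)
    have h := norm_sgdStep_sub_sq_le hB hL (ε := ε) (η := 1 / (m * t)) (θ := θ) hθstar z
    have h' : c * (t * ‖sgdStep φ ε B (1 / (m * t)) θ z - θstar‖ ^ 2) ≤
        c * (t * (‖θ - θstar‖ ^ 2 - 2 * (1 / (m * t)) * gradGap φ ε θ θstar z +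
          (1 / (m * t)) ^ 2 * (2 * L) ^ 2)) := by gcongr
    refine h'.trans_eq ?_
    rw [hc]
    field_simp
    ring
  refine (lintegral_mono hpt).trans ?_
  rw [lintegral_const_mul' _ _ ENNReal.ofReal_ne_top]
  refine (mul_le_mul_right (lintegral_exp_neg_gradGap_le hL hε hκ hθ.2 hθstar.2 hL0.le hs) _).trans ?_
  rw [← ENNReal.ofReal_mul (Real.exp_pos _).le, ← Real.exp_add]
  -- With s = 2c/m the mean contributes -2c D² and Hoeffding's term + c D²/2, because c = (m/4L)².
  -- The net -3/2 exceeds in size the growth by 1 of the weight t at each step.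
  refine ENNReal.ofReal_le_ofReal (Real.exp_le_exp.2 (le_of_eq ?_))
  change _ + (-(2 * c / m * (m * _)) + _) = _
  rw [hc]
  field_simp
  ring

end Moments

/-- Integration over a fresh sample inside an event of the past. -/
lemma setLIntegral_eq_of_indep {Ω X Y : Type*} [MeasurableSpace X] [MeasurableSpace Y]
    {F mΩ : MeasurableSpace Ω} {P : Measure Ω} [IsProbabilityMeasure P] (hF : F ≤ mΩ) {ν : Measure Y}
    {V : Ω → X} {W : Ω → Y} (hV : Measurable[F] V) (hW : HasLaw W ν P) (hWm : Measurable W)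
    (hind : Indep F (MeasurableSpace.comap W inferInstance) P)
    {f : X → Y → ENNReal} (hf : Measurable (Function.uncurry f)) {E : Set Ω}
    (hE : MeasurableSet[F] E) :
    ∫⁻ ω in E, f (V ω) (W ω) ∂P = ∫⁻ ω in E, ∫⁻ y, f (V ω) y ∂ν ∂P := by
  have : IsProbabilityMeasure ν := hW.map_eq ▸ Measure.isProbabilityMeasure_map hW.aemeasurable
  -- The event is carried along as one more past variable, so that the joint law of `(V, I)` and `W`
  -- is a product and Tonelli applies without conditional expectations.
  set I : Ω → ENNReal := E.indicator 1 with hI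
  have hIm : Measurable[F] I := (measurable_const (a := (1 : ENNReal))).indicator hE
  have hU : Measurable[F] fun ω => (V ω, I ω) := hV.prodMk hIm
  have hUm : Measurable fun ω => (V ω, I ω) := hU.mono hF le_rfl
  have hindU : IndepFun (fun ω => (V ω, I ω)) W P := by
    rw [IndepFun_iff_Indep]
    exact indep_of_indep_of_le_left hind hU.comap_le
  have hmap := (indepFun_iff_map_prod_eq_prod_map_map hUm.aemeasurable hWm.aemeasurable).1 hindU
  rw [hW.map_eq] at hmap
  set g : (X × ENNReal) × Y → ENNReal := fun p => p.1.2 * f p.1.1 p.2 with hg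
  have hgm : Measurable g := by
    have : Measurable fun p : (X × ENNReal) × Y => Function.uncurry f (p.1.1, p.2) :=
      hf.comp (by fun_prop)
    exact (by fun_prop : Measurable fun p : (X × ENNReal) × Y => p.1.2).mul this
  have hind1 : ∀ u : Ω → ENNReal, ∫⁻ ω in E, u ω ∂P = ∫⁻ ω, I ω * u ω ∂P := by
    intro u
    rw [← lintegral_indicator (hF _ hE)]
    refine lintegral_congr fun ω => ?_
    by_cases h : ω ∈ E <;> simp [hI, h]
  rw [hind1, hind1]
  calc ∫⁻ ω, I ω * f (V ω) (W ω) ∂P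
      = ∫⁻ p, g p ∂(P.map fun ω => ((V ω, I ω), W ω)) := by
        rw [lintegral_map hgm (hUm.prodMk hWm)]
    _ = ∫⁻ u, ∫⁻ y, g (u, y) ∂ν ∂(P.map fun ω => (V ω, I ω)) := by
        rw [hmap, lintegral_prod _ hgm.aemeasurable]
    _ = ∫⁻ ω, ∫⁻ y, g ((V ω, I ω), y) ∂ν ∂P := by
        rw [lintegral_map hgm.lintegral_prod_right' hUm]
    _ = ∫⁻ ω, I ω * ∫⁻ y, f (V ω) y ∂ν ∂P := by
        refine lintegral_congr fun ω => ?_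
        simp only [hg]
        rw [lintegral_const_mul]
        exact hf.comp measurable_prodMk_left

/-! ### Ville's inequality and the filtration of the samples -/

section Maximal

variable {Ω : Type*} {mΩ : MeasurableSpace Ω}

/-- Ville's maximal inequality for a nonnegative supermartingale on a finite time interval. -/
lemma mul_measure_exists_le_lintegral {P : Measure Ω} {F : ℕ → MeasurableSpace Ω}
    (hmono : Monotone F) (hF : ∀ t, F t ≤ mΩ) {M : ℕ → Ω → ENNReal}
    (hM : ∀ t, Measurable[F t] (M t)) {s T : ℕ}
    (hsup : ∀ t, s ≤ t → t < T → ∀ E, MeasurableSet[F t] E →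
      ∫⁻ ω in E, M (t + 1) ω ∂P ≤ ∫⁻ ω in E, M t ω ∂P) (a : ENNReal) (hsT : s ≤ T) :
    a * P {ω | ∃ t, s ≤ t ∧ t ≤ T ∧ a ≤ M t ω} ≤ ∫⁻ ω, M s ω ∂P := by
  have hB : ∀ t, MeasurableSet[F t] {ω | ∀ i, s ≤ i → i < t → M i ω < a} := by
    intro t
    simp only [Set.ofPred_forall]
    refine MeasurableSet.iInter fun i => MeasurableSet.iInter fun _ => MeasurableSet.iInter
      fun hi => ?_
    exact hmono hi.le _ (hM i measurableSet_Iio)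
  have hA : ∀ t, MeasurableSet[F t] {ω | a ≤ M t ω} := fun t => hM t measurableSet_Ici
  -- The quantity a · P(level reached before t) + ∫ of M_t over the complement does not increase
  -- when time t is added to the first event: on the newly removed part, a ≤ M_t.
  have hsplit : ∀ t, s ≤ t →
      a * P {ω | ∀ i, s ≤ i → i < t + 1 → M i ω < a}ᶜ +
        ∫⁻ ω in {ω | ∀ i, s ≤ i → i < t + 1 → M i ω < a}, M t ω ∂P ≤
      a * P {ω | ∀ i, s ≤ i → i < t → M i ω < a}ᶜ +
        ∫⁻ ω in {ω | ∀ i, s ≤ i → i < t → M i ω < a}, M t ω ∂P := by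
    intro t hst
    set B := {ω | ∀ i, s ≤ i → i < t → M i ω < a} with hBdef
    have hBt := hF t _ (hB t)
    have hAt := hF t _ (hA t)
    have e1 : {ω | ∀ i, s ≤ i → i < t + 1 → M i ω < a} = B \ {ω | a ≤ M t ω} := by
      ext ω
      simp only [hBdef, Set.mem_sdiff, Set.mem_ofPred_eq, not_le]
      constructor
      · exact fun h => ⟨fun i hi hit => h i hi (hit.trans (Nat.lt_succ_self t)),
          h t hst (Nat.lt_succ_self t)⟩
      · rintro ⟨h1, h2⟩ i hi hit
        rcases (Nat.lt_succ_iff.1 hit).eq_or_lt with rfl | h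
        · exact h2
        · exact h1 i hi h
    rw [e1, ← lintegral_inter_add_sdiff (μ := P) (M t) B hAt, ← add_assoc]
    gcongr
    have e2 : (B \ {ω | a ≤ M t ω})ᶜ = Bᶜ ∪ (B ∩ {ω | a ≤ M t ω}) := by
      ext ω
      simp only [Set.mem_compl_iff, Set.mem_sdiff, Set.mem_union, Set.mem_inter_iff]
      tauto
    rw [e2]
    refine (mul_le_mul_right (measure_union_le _ _) a).trans ?_
    rw [mul_add]
    gcongr
    rw [← setLIntegral_const]
    exact setLIntegral_mono' (hBt.inter hAt) fun ω hω => hω.2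
  have key : ∀ t, s ≤ t → t ≤ T →
      a * P {ω | ∀ i, s ≤ i → i < t → M i ω < a}ᶜ +
        ∫⁻ ω in {ω | ∀ i, s ≤ i → i < t → M i ω < a}, M t ω ∂P ≤ ∫⁻ ω, M s ω ∂P := by
    intro t hst
    induction t, hst using Nat.le_induction with
    | base =>
      intro _
      have : {ω | ∀ i, s ≤ i → i < s → M i ω < a} = Set.univ :=
        Set.eq_univ_of_forall fun ω i h1 h2 => absurd h2 h1.not_gt
      simp [this]
    | succ t hst ih =>
      intro hT
      refine le_trans ?_ ((hsplit t hst).trans (ih (Nat.le_of_succ_le hT)))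
      refine add_le_add le_rfl (hsup t hst hT _ ?_)
      simp only [Set.ofPred_forall]
      refine MeasurableSet.iInter fun i => MeasurableSet.iInter fun _ => MeasurableSet.iInter
        fun hi => ?_
      exact hmono (Nat.lt_succ_iff.1 hi) _ (hM i measurableSet_Iio)
  -- One further splitting without a supermartingale step, since the event in `key` at T excludes
  -- time T itself.
  refine le_trans ?_ (((hsplit T hsT)).trans (key T hsT le_rfl))
  refine le_trans (mul_le_mul_right (measure_mono ?_) a) le_self_add
  rintro ω ⟨t, h1, h2, h3⟩ h
  exact (h t h1 (Nat.lt_succ_of_le h2)).not_ge h3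

/-- The σ-algebra generated by the first `t` of `n` random variables. -/
@[reducible] def pastSigma {n : ℕ} {Y : Type*} [MeasurableSpace Y] (Z : Fin n → Ω → Y) (t : ℕ) :
    MeasurableSpace Ω :=
  ⨆ i ∈ {i : Fin n | (i : ℕ) < t}, MeasurableSpace.comap (Z i) inferInstance

variable {n : ℕ} {Y : Type*} [MeasurableSpace Y] {Z : Fin n → Ω → Y}

lemma pastSigma_mono : Monotone (pastSigma Z) := fun _ _ h =>
  biSup_mono fun _ hi => lt_of_lt_of_le hi h

lemma pastSigma_le (hZ : ∀ i, Measurable (Z i)) (t : ℕ) : pastSigma Z t ≤ mΩ :=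
  iSup₂_le fun i _ => (hZ i).comap_le

lemma measurable_pastSigma {t : ℕ} (h : t < n) : Measurable[pastSigma Z (t + 1)] (Z ⟨t, h⟩) :=
  measurable_iff_comap_le.2
    (le_iSup₂_of_le (f := fun i (_ : i ∈ {i : Fin n | (i : ℕ) < t + 1}) =>
      MeasurableSpace.comap (Z i) inferInstance) ⟨t, h⟩ (Nat.lt_succ_self t) le_rfl)

lemma indep_pastSigma {P : Measure Ω} (hZ : ∀ i, Measurable (Z i)) (hind : iIndepFun Z P)
    {t : ℕ} (h : t < n) :
    Indep (pastSigma Z t) (MeasurableSpace.comap (Z ⟨t, h⟩) inferInstance) P := by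
  have := indep_iSup_of_disjoint (fun i => (hZ i).comap_le) hind.iIndep
    (S := {i : Fin n | (i : ℕ) < t}) (T := {⟨t, h⟩}) (by simp)
  rwa [iSup_singleton] at this

end Maximal

/-! ### The iterates as a recursion, and the scaled error -/

section Iterates

variable {S A : Type*} {d n : ℕ} {B : ℝ}

lemma sgdRR_succ (φ : S → A → Vec d) (ε L B κ : ℝ) (z : Fin n → Sample S A) {t : ℕ} (h : t < n) :
    sgdRR φ ε L B κ z (t + 1) =
      sgdStep φ ε B (1 / (modulus ε L B κ * (t + 1 : ℕ))) (sgdRR φ ε L B κ z t) (z ⟨t, h⟩) := by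
  rw [sgdRR, sgdIterate]
  simp only [h, dif_pos]
  rfl

lemma sgdRR_succ_of_le (φ : S → A → Vec d) (ε L B κ : ℝ) (z : Fin n → Sample S A) {t : ℕ}
    (h : n ≤ t) : sgdRR φ ε L B κ z (t + 1) = sgdRR φ ε L B κ z t := by
  rw [sgdRR, sgdIterate]
  simp only [h.not_gt, dif_neg, not_false_eq_true]
  rfl

lemma sgdRR_mem (hB : 0 ≤ B) (φ : S → A → Vec d) (ε L κ : ℝ) (z : Fin n → Sample S A) (t : ℕ) :
    sgdRR φ ε L B κ z t ∈ paramSet d B := by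
  induction t with
  | zero => simp [sgdRR, sgdIterate, paramSet, hB]
  | succ t ih =>
    by_cases h : t < n
    · rw [sgdRR_succ _ _ _ _ _ _ h]
      exact euclideanProj_mem hB _
    · rwa [sgdRR_succ_of_le _ _ _ _ _ _ (not_lt.1 h)]

/-- The squared error after `t` updates, normalised to be of order `1`. -/
def scaledError (φ : S → A → Vec d) (ε L B κ : ℝ) (θstar : Vec d) (z : Fin n → Sample S A)
    (t : ℕ) : ℝ :=
  (modulus ε L B κ / (4 * L)) ^ 2 * (t * ‖sgdRR φ ε L B κ z t - θstar‖ ^ 2)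

end Iterates

/-! ### Exponential moments of the scaled error and dyadic blocks -/

section Concentration

variable {S A Ω : Type*} {d : ℕ} [MeasurableSpace S] [MeasurableSpace A]
  {mΩ : MeasurableSpace Ω} {P : Measure Ω} [IsProbabilityMeasure P]
  {ρ : Measure S} [IsProbabilityMeasure ρ] {μ : Kernel S (A × A)} [IsMarkovKernel μ]
  {φ : S → A → Vec d} {hφ : Measurable (Function.uncurry φ)} {n : ℕ}
  {Z : Fin n → Ω → Sample S A} {L B κ ε : ℝ} {θstar : Vec d}

lemma measurable_sgdRR (hB : 0 ≤ B) (hφ : Measurable (Function.uncurry φ)) (ε L κ : ℝ) (t : ℕ) :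
    Measurable[pastSigma Z t] fun ω => sgdRR φ ε L B κ (fun i => Z i ω) t := by
  induction t with
  | zero => exact measurable_const
  | succ t ih =>
    by_cases h : t < n
    · simp only [sgdRR_succ _ _ _ _ _ _ h]
      have h1 := @Measurable.mono _ _ _ _ _ _ _ ih (pastSigma_mono (Z := Z) (Nat.le_succ t)) le_rfl
      have h2 := measurable_pastSigma (Z := Z) h
      have h3 := measurable_sgdStep hφ ε (1 / (modulus ε L B κ * (t + 1 : ℕ))) hB
      have := h3.comp (h1.prodMk h2)
      exact this
    · simp only [sgdRR_succ_of_le _ _ _ _ _ _ (not_lt.1 h)]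
      exact ih.mono (pastSigma_mono (Nat.le_succ t)) le_rfl

lemma measurable_scaledError (hB : 0 ≤ B) (hφ : Measurable (Function.uncurry φ)) (ε L κ : ℝ)
    (θstar : Vec d) (t : ℕ) :
    Measurable[pastSigma Z t] fun ω => scaledError φ ε L B κ θstar (fun i => Z i ω) t := by
  have h := measurable_sgdRR (Z := Z) hB hφ ε L κ t
  have : Measurable fun θ : Vec d => (modulus ε L B κ / (4 * L)) ^ 2 * (t * ‖θ - θstar‖ ^ 2) := by
    fun_prop
  exact this.comp h

/-- The iterate after t updates depends on the first t samples only, so the fresh sample is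
integrated out with the iterate frozen. The weight (t+1) - 3/2 = t - 1/2 is t (1 - 1/(2t)). -/
lemma setLIntegral_exp_scaledError_succ_le (hL : ∀ s a, ‖φ s a‖ ≤ L) (hε : 0 < ε)
    (hκ : κ ≤ lambdaMin (featureCov ρ μ φ) (featureCov_isHermitian ρ μ φ))
    (hθstar : θstar ∈ paramSet d B) (hL0 : 0 < L) (hmod : 0 < modulus ε L B κ)
    (hZ : ∀ i, Measurable (Z i)) (hind : iIndepFun Z P)
    (hlaw : ∀ i, HasLaw (Z i) (sampleLaw ρ μ φ hφ θstar ε) P) {t : ℕ} (ht : 1 ≤ t) (htn : t < n)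
    {E : Set Ω} (hE : MeasurableSet[pastSigma Z t] E) :
    ∫⁻ ω in E, ENNReal.ofReal (Real.exp
        (scaledError φ ε L B κ θstar (fun i => Z i ω) (t + 1))) ∂P ≤
      ∫⁻ ω in E, ENNReal.ofReal (Real.exp
        ((1 - 1 / (2 * t)) * scaledError φ ε L B κ θstar (fun i => Z i ω) t +
          1 / (4 * (t + 1)))) ∂P := by
  have hB : 0 ≤ B := (norm_nonneg _).trans hθstar.2
  have ht0 : (0 : ℝ) < t := by exact_mod_cast ht
  simp only [scaledError, sgdRR_succ _ _ _ _ _ _ htn]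
  have hstep := measurable_sgdStep hφ ε (1 / (modulus ε L B κ * (t + 1 : ℕ))) hB
  rw [setLIntegral_eq_of_indep (pastSigma_le hZ t) (measurable_sgdRR hB hφ ε L κ t)
    (hlaw ⟨t, htn⟩) (hZ _) (indep_pastSigma hZ hind htn)
    (f := fun θ z => ENNReal.ofReal (Real.exp ((modulus ε L B κ / (4 * L)) ^ 2 *
      ((t + 1 : ℕ) * ‖sgdStep φ ε B (1 / (modulus ε L B κ * (t + 1 : ℕ))) θ z - θstar‖ ^ 2))))
    ?_ hE]
  · refine lintegral_mono fun ω => ?_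
    refine (lintegral_exp_sgdStep_le hL hε hκ (sgdRR_mem hB φ ε L κ _ t) hθstar hL0 hmod
      (t := (t + 1 : ℕ)) (by positivity)).trans_eq ?_
    congr 2
    push_cast
    field_simp
    ring
  · have : Measurable fun p : Vec d × Sample S A =>
        ((modulus ε L B κ / (4 * L)) ^ 2 * ((t + 1 : ℕ) *
          ‖Function.uncurry (sgdStep φ ε B (1 / (modulus ε L B κ * (t + 1 : ℕ)))) p - θstar‖ ^ 2)) := by
      fun_prop
    exact (Real.measurable_exp.comp this).ennreal_ofReal

/-- The level 1/2 is a fixed point: the exponent is at most the convex combination (1 - b) V_t + b/2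
with b = 1/(2t), as b/2 = 1/(4t) dominates the drift 1/(4(t+1)). -/
lemma lintegral_exp_scaledError_le (hL : ∀ s a, ‖φ s a‖ ≤ L) (hε : 0 < ε)
    (hκ : κ ≤ lambdaMin (featureCov ρ μ φ) (featureCov_isHermitian ρ μ φ))
    (hθstar : θstar ∈ paramSet d B) (hL0 : 0 < L) (hmod : 0 < modulus ε L B κ)
    (hZ : ∀ i, Measurable (Z i)) (hind : iIndepFun Z P)
    (hlaw : ∀ i, HasLaw (Z i) (sampleLaw ρ μ φ hφ θstar ε) P) {t : ℕ} (ht : 1 ≤ t) (htn : t ≤ n) :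
    ∫⁻ ω, ENNReal.ofReal (Real.exp (scaledError φ ε L B κ θstar (fun i => Z i ω) t)) ∂P ≤
      ENNReal.ofReal (Real.exp (1 / 2)) := by
  have hB : 0 ≤ B := (norm_nonneg _).trans hθstar.2
  induction t, ht using Nat.le_induction with
  | base =>
    have hle : ∀ ω, ENNReal.ofReal (Real.exp
        (scaledError φ ε L B κ θstar (fun i => Z i ω) 1)) ≤ ENNReal.ofReal (Real.exp (1 / 2)) := by
      intro ω
      refine ENNReal.ofReal_le_ofReal (Real.exp_le_exp.2 ?_)
      have h := norm_sub_mul_modulus_le hφ hL hε hκ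
        (sgdRR_mem hB φ ε L κ (fun i => Z i ω) 1).2 hθstar.2 hL0.le
      have h0 : 0 ≤ modulus ε L B κ * ‖sgdRR φ ε L B κ (fun i => Z i ω) 1 - θstar‖ := by positivity
      have h2 := pow_le_pow_left₀ h0 h 2
      have e : scaledError φ ε L B κ θstar (fun i => Z i ω) 1 =
          (modulus ε L B κ * ‖sgdRR φ ε L B κ (fun i => Z i ω) 1 - θstar‖) ^ 2 / (4 * L) ^ 2 := by
        rw [scaledError]
        field_simp
        simp
      rw [e, div_le_iff₀ (by positivity)]
      nlinarith [sq_nonneg L]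
    refine (lintegral_mono hle).trans ?_
    simp
  | succ t ht ih =>
    have ht0 : (1 : ℝ) ≤ t := by exact_mod_cast ht
    have h := setLIntegral_exp_scaledError_succ_le (E := Set.univ) hL hε hκ hθstar hL0 hmod hZ hind
      hlaw ht htn MeasurableSet.univ
    rw [setLIntegral_univ, setLIntegral_univ] at h
    refine h.trans ?_
    set b : ℝ := 1 / (2 * t) with hb
    have hb0 : 0 ≤ b := by positivity
    have hb1 : 0 ≤ 1 - b := by
      rw [hb, sub_nonneg, div_le_one (by positivity)]
      linarith
    have hpt : ∀ x : ℝ, ENNReal.ofReal (Real.exp ((1 - b) * x + 1 / (4 * (t + 1)))) ≤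
        ENNReal.ofReal (1 - b) * ENNReal.ofReal (Real.exp x) +
          ENNReal.ofReal b * ENNReal.ofReal (Real.exp (1 / 2)) := by
      intro x
      rw [← ENNReal.ofReal_mul hb1, ← ENNReal.ofReal_mul hb0, ← ENNReal.ofReal_add (by positivity)
        (by positivity)]
      refine ENNReal.ofReal_le_ofReal ?_
      have hc := convexOn_exp.2 (Set.mem_univ x) (Set.mem_univ (1 / 2 : ℝ)) hb1 hb0 (by ring)
      simp only [smul_eq_mul] at hc
      refine (Real.exp_le_exp.2 ?_).trans hc
      have : (1 : ℝ) / (4 * (t + 1)) ≤ b * (1 / 2) := by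
        rw [hb, div_mul_div_comm, one_mul]
        exact one_div_le_one_div_of_le (by positivity) (by linarith)
      linarith
    refine (lintegral_mono fun ω => hpt _).trans ?_
    rw [lintegral_add_right _ measurable_const, lintegral_const_mul' _ _ ENNReal.ofReal_ne_top,
      lintegral_const, measure_univ, mul_one]
    calc _ ≤ ENNReal.ofReal (1 - b) * ENNReal.ofReal (Real.exp (1 / 2)) +
          ENNReal.ofReal b * ENNReal.ofReal (Real.exp (1 / 2)) := by
          gcongr
          exact ih (Nat.le_of_succ_le htn)
      _ = ENNReal.ofReal (Real.exp (1 / 2)) := by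
          rw [← add_mul, ← ENNReal.ofReal_add hb1 hb0, sub_add_cancel, ENNReal.ofReal_one, one_mul]

/-- The error bound on the dyadic block `[s, 2s]`. -/
lemma measure_exists_scaledError_ge_le (hL : ∀ s a, ‖φ s a‖ ≤ L) (hε : 0 < ε)
    (hκ : κ ≤ lambdaMin (featureCov ρ μ φ) (featureCov_isHermitian ρ μ φ))
    (hθstar : θstar ∈ paramSet d B) (hL0 : 0 < L) (hmod : 0 < modulus ε L B κ)
    (hZ : ∀ i, Measurable (Z i)) (hind : iIndepFun Z P)
    (hlaw : ∀ i, HasLaw (Z i) (sampleLaw ρ μ φ hφ θstar ε) P) {s : ℕ} (hs : 1 ≤ s) (hsn : s ≤ n)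
    (x : ℝ) :
    P {ω | ∃ t, s ≤ t ∧ t ≤ 2 * s ∧ t ≤ n ∧
      x + 3 / 4 ≤ scaledError φ ε L B κ θstar (fun i => Z i ω) t} ≤
      ENNReal.ofReal (Real.exp (-x)) := by
  have hB : 0 ≤ B := (norm_nonneg _).trans hθstar.2
  have hs0 : (0 : ℝ) < s := by exact_mod_cast hs
  -- The compensator grows by 1/(4s) per step, which bounds every drift 1/(4(t+1)) in the block, and
  -- reaches at most 1/4 at t = 2s. With the initial moment e^{1/2} this explains the offset 3/4 =
  -- 1/2 + 1/4.
  set M : ℕ → Ω → ENNReal := fun t ω => ENNReal.ofReal (Real.exp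
    (scaledError φ ε L B κ θstar (fun i => Z i ω) t - ((t : ℝ) - s) / (4 * s))) with hM
  have hMm : ∀ t, Measurable[pastSigma Z t] (M t) := by
    intro t
    have : Measurable fun r : ℝ => ENNReal.ofReal (Real.exp (r - ((t : ℝ) - s) / (4 * s))) := by
      fun_prop
    exact this.comp (measurable_scaledError hB hφ ε L κ θstar t)
  have hfac : ∀ t ω, M t ω = ENNReal.ofReal (Real.exp (-(((t : ℝ) - s) / (4 * s)))) *
      ENNReal.ofReal (Real.exp (scaledError φ ε L B κ θstar (fun i => Z i ω) t)) := by
    intro t ω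
    rw [← ENNReal.ofReal_mul (Real.exp_pos _).le, ← Real.exp_add, hM]
    ring_nf
  have hville := mul_measure_exists_le_lintegral (P := P) (s := s) (T := min (2 * s) n)
    pastSigma_mono (pastSigma_le hZ) hMm ?_ (ENNReal.ofReal (Real.exp (x + 1 / 2)))
    (le_min (by omega) hsn)
  · have h0 : ∫⁻ ω, M s ω ∂P ≤ ENNReal.ofReal (Real.exp (1 / 2)) := by
      simpa [hM] using lintegral_exp_scaledError_le hL hε hκ hθstar hL0 hmod hZ hind hlaw hs hsn
    have hsub : P {ω | ∃ t, s ≤ t ∧ t ≤ 2 * s ∧ t ≤ n ∧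
        x + 3 / 4 ≤ scaledError φ ε L B κ θstar (fun i => Z i ω) t} ≤
        P {ω | ∃ t, s ≤ t ∧ t ≤ min (2 * s) n ∧ ENNReal.ofReal (Real.exp (x + 1 / 2)) ≤ M t ω} := by
      refine measure_mono ?_
      rintro ω ⟨t, h1, h2, h3, h4⟩
      refine ⟨t, h1, le_min h2 h3, ENNReal.ofReal_le_ofReal (Real.exp_le_exp.2 ?_)⟩
      have : ((t : ℝ) - s) / (4 * s) ≤ 1 / 4 := by
        have h2' : (t : ℝ) ≤ 2 * s := by exact_mod_cast h2
        rw [div_le_div_iff₀ (by positivity) (by norm_num)]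
        linarith
      linarith
    refine hsub.trans ?_
    have h1 := hville.trans h0
    rw [mul_comm, ← ENNReal.le_div_iff_mul_le (Or.inl (by simp [Real.exp_pos]))
      (Or.inl ENNReal.ofReal_ne_top), ← ENNReal.ofReal_div_of_pos (Real.exp_pos _),
      ← Real.exp_sub] at h1
    refine h1.trans_eq ?_
    ring_nf
  · intro t hst htT E hE
    have ht1 : 1 ≤ t := hs.trans hst
    have htn : t < n := lt_of_lt_of_le htT (min_le_right _ _)
    have hst' : (s : ℝ) ≤ t := by exact_mod_cast hst
    have h := setLIntegral_exp_scaledError_succ_le hL hε hκ hθstar hL0 hmod hZ hind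
      hlaw ht1 htn hE
    simp only [hfac]
    rw [lintegral_const_mul' _ _ ENNReal.ofReal_ne_top, ← lintegral_const_mul' _ _
      ENNReal.ofReal_ne_top]
    rw [lintegral_const_mul' _ _ ENNReal.ofReal_ne_top]
    refine (mul_le_mul_right h _).trans ?_
    rw [← lintegral_const_mul' _ _ ENNReal.ofReal_ne_top]
    refine lintegral_mono fun ω => ?_
    rw [← ENNReal.ofReal_mul (Real.exp_pos _).le, ← ENNReal.ofReal_mul (Real.exp_pos _).le,
      ← Real.exp_add, ← Real.exp_add]
    refine ENNReal.ofReal_le_ofReal (Real.exp_le_exp.2 ?_)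
    have hnn : 0 ≤ scaledError φ ε L B κ θstar (fun i => Z i ω) t := by
      unfold scaledError
      positivity
    have hdrift : (1 : ℝ) / (4 * (t + 1)) ≤ 1 / (4 * s) :=
      one_div_le_one_div_of_le (by positivity) (by linarith)
    have hshr : 0 ≤ 1 / (2 * (t : ℝ)) * scaledError φ ε L B κ θstar (fun i => Z i ω) t := by
      positivity
    have e : (((t + 1 : ℕ) : ℝ) - s) / (4 * s) = ((t : ℝ) - s) / (4 * s) + 1 / (4 * s) := by
      push_cast
      ring
    rw [e]
    linarith

end Concentration

/-! ### Union bound over the blocks and numerical constants -/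

section Conclusion

/-- If L ≤ 0 then all features coincide and the covariance vanishes. In dimension 0 the infimum over
no eigenvalues is 0 by convention, so coverage fails as well. -/
lemma pos_of_pos_le_lambdaMin {S A : Type*} {d : ℕ} [MeasurableSpace S] [MeasurableSpace A]
    {ρ : Measure S} [IsProbabilityMeasure ρ] {μ : Kernel S (A × A)} [IsMarkovKernel μ]
    {φ : S → A → Vec d} (hφ : Measurable (Function.uncurry φ)) {L κ : ℝ}
    (hL : ∀ s a, ‖φ s a‖ ≤ L) (hκ0 : 0 < κ)
    (hκ : κ ≤ lambdaMin (featureCov ρ μ φ) (featureCov_isHermitian ρ μ φ)) : 0 < L := by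
  rcases Nat.eq_zero_or_pos d with rfl | hd
  · rw [lambdaMin, Real.iInf_of_isEmpty] at hκ
    linarith
  by_contra! h
  have h1 := mul_norm_sq_le_integral_inner_sq hφ hL hκ (EuclideanSpace.single ⟨0, hd⟩ (1 : ℝ))
  have h0 : ∀ q, diffFeature φ q = 0 := fun q =>
    norm_le_zero_iff.1 ((norm_diffFeature_le hL q).trans (by linarith))
  simp [h0] at h1
  linarith

lemma two_mul_sigmoid_sub_one (ε : ℝ) :
    2 * Real.sigmoid ε - 1 = (Real.exp ε - 1) / (Real.exp ε + 1) := by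
  rw [Real.sigmoid_def, Real.exp_neg]
  have := Real.exp_pos ε
  field_simp
  ring

lemma modulus_pos {ε κ : ℝ} (hε : 0 < ε) (hκ : 0 < κ) (L B : ℝ) : 0 < modulus ε L B κ := by
  have h1 : 0 < 2 * Real.sigmoid ε - 1 := by
    have := Real.sigmoid_lt hε
    rw [Real.sigmoid_zero] at this
    linarith
  exact mul_pos (mul_pos h1 (curvature_pos L B)) hκ

/-- The union bound over the dyadic blocks costs only a constant factor. -/
lemma log_card_blocks_le {n : ℕ} (hn : 2 ≤ n) {α : ℝ} (hα : 0 < α) (hα1 : α < Real.exp (-1)) :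
    Real.log ((Nat.log 2 n + 1 : ℕ) / α) + 3 / 4 ≤ 4 * Real.log (Real.log n / α) := by
  have hn' : (2 : ℝ) ≤ n := by exact_mod_cast hn
  have hlog2 := Real.log_two_gt_d9
  have hlogn : Real.log 2 ≤ Real.log n := Real.log_le_log (by norm_num) hn'
  have hlogn0 : 0 < Real.log n := by linarith
  have hblocks : ((Nat.log 2 n + 1 : ℕ) : ℝ) ≤ 3 * Real.log n := by
    have h1 : ((Nat.log 2 n : ℕ) : ℝ) * Real.log 2 ≤ Real.log n := by
      rw [← Real.log_pow]
      refine Real.log_le_log (by positivity) ?_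
      exact_mod_cast Nat.pow_log_le_self 2 (by omega)
    have h2 : ((Nat.log 2 n : ℕ) : ℝ) * 0.69 ≤ Real.log n :=
      (mul_le_mul_of_nonneg_left (by linarith) (Nat.cast_nonneg _)).trans h1
    push_cast
    linarith
  -- The assumption α < 1/e keeps the logarithm away from 0, so that three further copies of it
  -- absorb log 3 + 3/4 ≤ 1.86.
  have hlow : 0.62 ≤ Real.log (Real.log n / α) := by
    have h1 : 0.69 * Real.exp 1 ≤ Real.log n / α := by
      rw [le_div_iff₀ hα]
      have : Real.exp 1 * α ≤ 1 := by
        calc Real.exp 1 * α ≤ Real.exp 1 * Real.exp (-1) := by gcongr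
          _ = 1 := by rw [← Real.exp_add]; simp
      nlinarith
    have h2 : Real.log (0.69 * Real.exp 1) ≤ Real.log (Real.log n / α) :=
      Real.log_le_log (by positivity) h1
    rw [Real.log_mul (by norm_num) (Real.exp_pos 1).ne', Real.log_exp] at h2
    have h3 : -0.38 ≤ Real.log 0.69 := by
      rw [Real.le_log_iff_exp_le (by norm_num)]
      have h4 := Real.quadratic_le_exp_of_nonneg (x := 0.38) (by norm_num)
      have h5 : (1.45 : ℝ) ≤ Real.exp 0.38 := by norm_num at h4 ⊢; linarith
      rw [Real.exp_neg]
      calc (Real.exp 0.38)⁻¹ ≤ (1.45 : ℝ)⁻¹ := inv_anti₀ (by norm_num) h5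
        _ ≤ 0.69 := by norm_num
    linarith
  have hlog3 : Real.log 3 ≤ 1.11 := by
    rw [Real.log_le_iff_le_exp (by norm_num)]
    have h4 : (0.11 : ℝ) + 1 ≤ Real.exp 0.11 := Real.add_one_le_exp _
    have h5 := Real.exp_one_gt_d9
    rw [show (1.11 : ℝ) = 1 + 0.11 by norm_num, Real.exp_add]
    nlinarith
  have hup : Real.log ((Nat.log 2 n + 1 : ℕ) / α) ≤ Real.log 3 + Real.log (Real.log n / α) := by
    rw [← Real.log_mul (by norm_num) (by positivity)]
    refine Real.log_le_log (by positivity) ?_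
    rw [← mul_div_assoc]
    gcongr
  linarith

lemma norm_sgdRR_sub_le_of_scaledError_le {S A : Type*} {d n t : ℕ} {φ : S → A → Vec d}
    {L B κ ε l : ℝ} {θstar : Vec d} {z : Fin n → Sample S A} (hε : 0 < ε) (hκ : 0 < κ)
    (hL : 0 < L) (ht : 1 ≤ t) (h : scaledError φ ε L B κ θstar z t ≤ 4 * l) :
    ‖sgdRR φ ε L B κ z t - θstar‖ ≤
      8 * (L / (curvature L B * κ)) * ((Real.exp ε + 1) / (Real.exp ε - 1)) * √(l / t) := by
  have hm := modulus_pos hε hκ L B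
  have hc := curvature_pos L B
  have ht0 : (0 : ℝ) < t := by exact_mod_cast ht
  have he : 0 < Real.exp ε - 1 := sub_pos.2 (Real.one_lt_exp_iff.2 hε)
  have hfac : 8 * (L / (curvature L B * κ)) * ((Real.exp ε + 1) / (Real.exp ε - 1)) =
      8 * L / modulus ε L B κ := by
    rw [modulus, two_mul_sigmoid_sub_one]
    have := Real.exp_pos ε
    field_simp
  rw [hfac, ← Real.sqrt_sq (norm_nonneg _), ← Real.sqrt_sq (by positivity : 0 ≤ 8 * L / modulus ε L B κ),
    ← Real.sqrt_mul (sq_nonneg _)]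
  refine Real.sqrt_le_sqrt ?_
  rw [scaledError, div_pow, div_mul_eq_mul_div, div_le_iff₀ (by positivity)] at h
  rw [div_pow, div_mul_div_comm, le_div_iff₀ (by positivity)]
  nlinarith

variable {S A Ω : Type*} {d : ℕ} [MeasurableSpace S] [MeasurableSpace A]
  {mΩ : MeasurableSpace Ω} {P : Measure Ω} [IsProbabilityMeasure P]
  {ρ : Measure S} [IsProbabilityMeasure ρ] {μ : Kernel S (A × A)} [IsMarkovKernel μ]
  {φ : S → A → Vec d} {hφ : Measurable (Function.uncurry φ)} {n : ℕ}
  {Z : Fin n → Ω → Sample S A} {L B κ ε α : ℝ} {θstar : Vec d}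

lemma measure_exists_scaledError_gt_le (hL : ∀ s a, ‖φ s a‖ ≤ L) (hε : 0 < ε) (hκ0 : 0 < κ)
    (hκ : κ ≤ lambdaMin (featureCov ρ μ φ) (featureCov_isHermitian ρ μ φ))
    (hθstar : θstar ∈ paramSet d B) (hα : 0 < α)
    (hZ : ∀ i, Measurable (Z i)) (hind : iIndepFun Z P)
    (hlaw : ∀ i, HasLaw (Z i) (sampleLaw ρ μ φ hφ θstar ε) P) :
    P {ω | ∃ t, 1 ≤ t ∧ t ≤ n ∧ Real.log ((Nat.log 2 n + 1 : ℕ) / α) + 3 / 4 <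
      scaledError φ ε L B κ θstar (fun i => Z i ω) t} ≤ ENNReal.ofReal α := by
  have hL0 := pos_of_pos_le_lambdaMin hφ hL hκ0 hκ
  have hmod := modulus_pos hε hκ0 L B
  set K := Nat.log 2 n + 1
  set x := Real.log ((K : ℕ) / α)
  have hK : (0 : ℝ) < K := by positivity
  have hblock : ∀ k ∈ Finset.range K, P {ω | ∃ t, 2 ^ k ≤ t ∧ t ≤ 2 * 2 ^ k ∧ t ≤ n ∧
      x + 3 / 4 ≤ scaledError φ ε L B κ θstar (fun i => Z i ω) t} ≤ ENNReal.ofReal (α / K) := by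
    intro k hk
    rcases Nat.eq_zero_or_pos n with rfl | hn
    · simp
    have hkn : 2 ^ k ≤ n :=
      Nat.pow_le_of_le_log hn.ne' (Nat.lt_succ_iff.1 (Finset.mem_range.1 hk))
    refine (measure_exists_scaledError_ge_le hL hε hκ hθstar hL0 hmod hZ hind hlaw
      Nat.one_le_two_pow hkn x).trans_eq ?_
    rw [Real.exp_neg, Real.exp_log (by positivity), inv_div]
  have hcover : {ω | ∃ t, 1 ≤ t ∧ t ≤ n ∧
      x + 3 / 4 < scaledError φ ε L B κ θstar (fun i => Z i ω) t} ⊆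
      ⋃ k ∈ Finset.range K, {ω | ∃ t, 2 ^ k ≤ t ∧ t ≤ 2 * 2 ^ k ∧ t ≤ n ∧
        x + 3 / 4 ≤ scaledError φ ε L B κ θstar (fun i => Z i ω) t} := by
    rintro ω ⟨t, h1, h2, h3⟩
    refine Set.mem_iUnion₂.2 ⟨Nat.log 2 t, Finset.mem_range.2
      (Nat.lt_succ_of_le (Nat.log_mono_right h2)), t, Nat.pow_log_le_self 2 (by omega), ?_, h2, h3.le⟩
    have := Nat.lt_pow_succ_log_self (b := 2) one_lt_two t
    rw [pow_succ'] at this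
    exact this.le
  refine (measure_mono hcover).trans ((measure_biUnion_finset_le _ _).trans
    ((Finset.sum_le_sum hblock).trans_eq ?_))
  rw [Finset.sum_const, Finset.card_range, nsmul_eq_mul, ← ENNReal.ofReal_natCast,
    ← ENNReal.ofReal_mul hK.le, mul_div_cancel₀ _ hK.ne']

end Conclusion

end PrivatePreference

end

theorem mainTheorem4 :
    ∃ C : ℝ, 0 < C ∧
      ∀ {S A Ω : Type*} [MeasurableSpace S] [MeasurableSpace A] [MeasurableSpace Ω]
        (P : Measure Ω) [IsProbabilityMeasure P]
        (d n : ℕ) (_hn : 2 ≤ n)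
        (ρ : Measure S) [IsProbabilityMeasure ρ]
        (μ : Kernel S (A × A)) [IsMarkovKernel μ]
        (φ : S → A → Vec d) (hφ : Measurable (Function.uncurry φ))
        (L B κ ε α : ℝ) (θstar : Vec d),
        -- boundedness
        θstar ∈ paramSet d B →
        (∀ s a, ‖φ s a‖ ≤ L) →
        -- coverage
        0 < κ →
        κ ≤ lambdaMin (featureCov ρ μ φ) (featureCov_isHermitian ρ μ φ) →
        0 < ε →
        0 < α → α < Real.exp (-1) →
        -- the data: `n` i.i.d. samples with labels privatized by randomized response
        ∀ Z : Fin n → Ω → Sample S A,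
          iIndepFun Z P →
          (∀ i, HasLaw (Z i) (sampleLaw ρ μ φ hφ θstar ε) P) →
          -- the iterates `θ̂_{t+1}` for `1 ≤ t ≤ n`; the output of the algorithm is the case `t = n`
          1 - α ≤ P.real {ω | ∀ t : ℕ, 1 ≤ t → t ≤ n →
            ‖sgdRR φ ε L B κ (fun i => Z i ω) t - θstar‖ ≤
              C * (L / (curvature L B * κ)) * ((Real.exp ε + 1) / (Real.exp ε - 1)) *
                √(Real.log (Real.log n / α) / t)} := by
  refine ⟨8, by norm_num, ?_⟩
  intro S A Ω _ _ _ P _ d n hn ρ _ μ _ φ hφ L B κ ε α θstar hθstar hL hκ0 hκ hε hα hα1 Z hind hlaw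
  have hL0 := pos_of_pos_le_lambdaMin hφ hL hκ0 hκ
  -- `HasLaw` gives only almost everywhere measurability; the martingale argument is run on
  -- measurable modifications.
  set Z' : Fin n → Ω → Sample S A := fun i => (hlaw i).aemeasurable.mk (Z i)
  have hZ' : ∀ i, Measurable (Z' i) := fun i => (hlaw i).aemeasurable.measurable_mk
  have hae : ∀ i, Z i =ᵐ[P] Z' i := fun i => (hlaw i).aemeasurable.ae_eq_mk
  have hind' : iIndepFun Z' P := hind.congr hae
  have hlaw' : ∀ i, HasLaw (Z' i) (sampleLaw ρ μ φ hφ θstar ε) P := fun i =>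
    ⟨(hZ' i).aemeasurable, by rw [← Measure.map_congr (hae i), (hlaw i).map_eq]⟩
  set good := {ω | ∀ t : ℕ, 1 ≤ t → t ≤ n → ‖sgdRR φ ε L B κ (fun i => Z i ω) t - θstar‖ ≤
    8 * (L / (curvature L B * κ)) * ((Real.exp ε + 1) / (Real.exp ε - 1)) *
      √(Real.log (Real.log n / α) / t)}
  set bad := {ω | ∃ t, 1 ≤ t ∧ t ≤ n ∧ Real.log ((Nat.log 2 n + 1 : ℕ) / α) + 3 / 4 <
    scaledError φ ε L B κ θstar (fun i => Z' i ω) t}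
  have hbad : P.real bad ≤ α := ENNReal.toReal_le_of_le_ofReal hα.le
    (measure_exists_scaledError_gt_le hL hε hκ0 hκ hθstar hα hZ' hind' hlaw')
  -- The good event need not be measurable, so its probability is bounded below by subadditivity
  -- instead of by passing to the complement.
  have hcover : (Set.univ : Set Ω) ≤ᵐ[P] (good ∪ bad : Set Ω) := by
    filter_upwards [ae_all_iff.2 hae] with ω hω _
    by_cases hb : ω ∈ bad
    · exact Or.inr hb
    · refine Or.inl fun t h1 h2 => norm_sgdRR_sub_le_of_scaledError_le hε hκ0 hL0 h1 ?_
      have h3 : ¬ _ < _ := fun h => hb ⟨t, h1, h2, h⟩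
      simp only [hω]
      exact (not_lt.1 h3).trans (log_card_blocks_le hn hα hα1)
  have hone : (1 : ℝ) ≤ P.real (good ∪ bad) := by
    rw [← probReal_univ (μ := P)]
    exact ENNReal.toReal_mono (measure_ne_top _ _) (measure_mono_ae hcover)
  have := measureReal_union_le (μ := P) good bad
  linarith
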